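/- **Setting.** Let $n\ge 1$ and let $M$ be a non-empty smooth manifold of dimension $2n$. On a real vector bundle or space of the form $T\oplus T^*$ let $\langle X+\alpha,Y+\beta\rangle=\tfrac12\big(\alpha(Y)+\beta(X)\big)$. Let $g$ be a smooth pseudo-Riemannian metric of signature $(n,n)$ and $\Theta$ a smooth $2$-form on $M$, both viewed as maps $TM\to T^*M$, and let $E=\{X+g(X)+\Theta(X): X\in TM\}\subset TM\oplus T^*M$ be the corresponding generalized metric. Put $E'=E$ and $E''=E^\perp$, the orthogonal complement for $\langle\cdot,\cdot\rangle$, so that $TM\oplus T^*M=E'\oplus E''$. The *generalized reflector space* $\mathcal G$ is the bundle over $M$ whose fibre at $p$ consists of all endomorphisms $K$ of $T_pM\oplus T_p^*M$ with $K^2=\mathrm{Id}$, $K\neq\pm\mathrm{Id}$, $\langle Ka,b\rangle+\langle a,Kb\rangle=0$ for all $a,b$, and $K E_p\subset E_p$. Let $D'$, $D''$ be any smooth connections on $E'$, $E''$ that preserve the restrictions of $\langle\cdot,\cdot\rangle$, and let $D=D'\oplus D''$. The horizontal space at $K\in\mathcal G$ of the connection induced by $D$ on $\mathrm{End}(TM\oplus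 T^*M)$ is tangent to $\mathcal G$, so $T\mathcal G=\mathcal H\oplus\mathcal V$, where $\mathcal H_K\cong T_pM$ ($p$ being the base point of $K$) and the vertical space $\mathcal V_K$ consists of the endomorphisms $V$ of $T_pM\oplus T_p^*M$ that are skew-symmetric for $\langle\cdot,\cdot\rangle$, map $E_p$ into itself and satisfy $VK+KV=0$. Write $K=(K',K'')$ and $V=(V',V'')$ for the restrictions to $E'_p$ and $E''_p$, and define $\mathcal P_\varepsilon:\mathcal V_K\to\mathcal V_K$ by $$\mathcal P_1V=(K'V',K''V''),\quad \mathcal P_2V=(K'V',-K''V''),\quad \mathcal P_3V=(-K'V',K''V''),\quad \mathcal P_4V=(-K'V',-K''V'').$$ For $\varepsilon=1,2,3,4$ let $\mathcal K_\varepsilon$ be the endomorphism of $T\mathcal G\oplus T^*\mathcal G=(\mathcal H\oplus\mathcal H^*)\oplus(\mathcal V\oplus\mathcal V^*)$ which at $K\in\mathcal G$ equals the lift of $K$ under $\mathcal H_K\oplus\mathcal H_K^*\cong T_pM\oplus T_p^*M$ on $\mathcal H_K\oplus\mathcal H_K^*$, equals $\mathcal P_\varepsilon$ on $\mathcal V_K$,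 and equals $-\mathcal P_\varepsilon^*$ on $\mathcal V_K^*$. For a $2$-form $B$ on $\mathcal G$ let $e^B(X+\alpha)=X+\alpha+\imath_XB$. A field $\mathcal J$ of endomorphisms of $T\mathcal G\oplus T^*\mathcal G$ is a *$B$-transform* of another one, $\mathcal J_0$, if $\mathcal J=e^B\mathcal J_0e^{-B}$ for some $2$-form $B$ on $\mathcal G$. **Proposition.** For every $\varepsilon\in\{1,2,3,4\}$, the generalized almost paracomplex structure $\mathcal K_\varepsilon$ is not a $B$-transform of any of the following structures on $\mathcal G$: 1. the trivial one, $X+\alpha\mapsto X-\alpha$; 2. $\mathcal K_\omega(X+\alpha)=\omega^{-1}(\alpha)+\omega(X)$, for any non-degenerate $2$-form $\omega$ on $\mathcal G$; 3. $\mathcal K_\pi(X+\alpha)=X-\imath_\alpha\pi-\alpha$, for any field $\pi$ of $2$-vectors on $\mathcal G$, where $\beta(\imath_\alpha\pi)=(\alpha\wedge\beta)(\pi)$; 4. $\mathcal K_P(X+\alpha)=PX-P^*\alpha$, for any field $P$ of endomorphisms of $T\mathcal G$ with $P^2=\mathrm{Id}$ and $P\neq\pm\mathrm{Id}$ at every point.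 Here the fields $B$, $\omega$, $\pi$, $P$ are arbitrary; not even their continuity is assumed. -/

import Mathlib

noncomputable section

namespace GenReflector

open ContDiff Topology Filter

set_option linter.unusedSectionVars false

section Linear

variable {T : Type*} [AddCommGroup T] [Module ℝ T]

/-- The space `T ⊕ T*`. -/
abbrev Gen (T : Type*) [AddCommGroup T] [Module ℝ T] : Type _ := T × Module.Dual ℝ T

/-- `e^B : X + α ↦ X + α + ι_X B`, for a bilinear form `B` on `T`. -/
def expB (B : LinearMap.BilinForm ℝ T) : Module.End ℝ (Gen T) where
  toFun a := (a.1, a.2 + B a.1)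
  map_add' a b := by ext <;> simp; abel
  map_smul' c a := by ext <;> simp

/-- The trivial generalized paracomplex structure `X + α ↦ X - α`. -/
def trivialStr : Module.End ℝ (Gen T) where
  toFun a := (a.1, -a.2)
  map_add' a b := by ext <;> simp; abel
  map_smul' c a := by ext <;> simp

/-- `K_ω (X + α) = ω⁻¹(α) + ω(X)`, for a non-degenerate `2`-form `ω`, with `ω(X) = ω(X, ·)`. -/
def symplecticStr [FiniteDimensional ℝ T] (w : LinearMap.BilinForm ℝ T) (hw : w.Nondegenerate) :
    Module.End ℝ (Gen T) where
  toFun a := ((w.toDual hw).symm a.2, w.toDual hw a.1)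
  map_add' a b := by ext <;> simp
  map_smul' c a := by ext <;> simp

/-- The alternating map `(u, v) ↦ α(u) v - α(v) u`. -/
def contractAlt (α : Module.Dual ℝ T) : T [⋀^Fin 2]→ₗ[ℝ] T where
  toFun m := α (m 0) • m 1 - α (m 1) • m 0
  map_update_add' m i x y := by
    fin_cases i <;> simp [add_smul] <;> module
  map_update_smul' m i c x := by
    fin_cases i <;> simp [mul_smul, smul_sub] <;> module
  map_eq_zero_of_eq' v i j h hij := by
    fin_cases i <;> fin_cases j <;> simp_all

/-- The contraction `ι_α π ∈ T` of a `2`-vector `π`, so that `ι_α (u ∧ v) = α(u) v - α(v) u`, that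
is, `β(ι_α π) = (α ∧ β)(π)`. -/
def contract (α : Module.Dual ℝ T) : ⋀[ℝ]^2 T →ₗ[ℝ] T :=
  exteriorPower.alternatingMapLinearEquiv (contractAlt α)

theorem contract_add (α β : Module.Dual ℝ T) (b : ⋀[ℝ]^2 T) :
    contract (α + β) b = contract α b + contract β b := by
  have : contractAlt (α + β) = contractAlt α + contractAlt β := by
    ext m; simp [contractAlt]; module
  simp [contract, this]

theorem contract_smul (c : ℝ) (α : Module.Dual ℝ T) (b : ⋀[ℝ]^2 T) :
    contract (c • α) b = c • contract α b := by
  have : contractAlt (c • α) = c • contractAlt α := by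
    ext m; simp [contractAlt]; module
  simp [contract, this]

/-- `K_π (X + α) = X - ι_α π - α`. -/
def bivectorStr (b : ⋀[ℝ]^2 T) : Module.End ℝ (Gen T) where
  toFun a := (a.1 - contract a.2 b, -a.2)
  map_add' a b := by ext <;> simp [contract_add] <;> abel
  map_smul' c a := by ext <;> simp [contract_smul, smul_sub]

/-- `K_P (X + α) = P X - P* α`. -/
def productStr (P : Module.End ℝ T) : Module.End ℝ (Gen T) where
  toFun a := (P a.1, -(a.2 ∘ₗ P))
  map_add' a b := by ext <;> simp; abel
  map_smul' c a := by ext <;> simp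

/-- A product structure on a vector space. -/
def IsProductStr (P : Module.End ℝ T) : Prop := P * P = 1 ∧ P ≠ 1 ∧ P ≠ -1

/-- Given a splitting `Φ : T ⊕ V ≃ W`, an endomorphism `J` of `T ⊕ T*` and an endomorphism `P` of
`V`, the endomorphism of `W ⊕ W* = (T ⊕ T*) ⊕ (V ⊕ V*)` that is `J` on `T ⊕ T*`, `P` on `V` and
`-P*` on `V*`. Here `V*` and `T*` are the annihilators of `T` and of `V` in `W*`. -/
def liftStr {W V : Type*} [AddCommGroup W] [Module ℝ W] [AddCommGroup V] [Module ℝ V]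
    [TopologicalSpace T] [IsTopologicalAddGroup T] [ContinuousSMul ℝ T] [T2Space T]
    [FiniteDimensional ℝ T] (Φ : (T × V) ≃ₗ[ℝ] W)
    (J : (T × (T →L[ℝ] ℝ)) →L[ℝ] (T × (T →L[ℝ] ℝ))) (P : V →ₗ[ℝ] V) : Module.End ℝ (Gen W) :=
  -- the component in `T ⊕ T*`
  let h : Gen W →ₗ[ℝ] T × (T →L[ℝ] ℝ) :=
    { toFun := fun a => ((Φ.symm a.1).1,
        LinearMap.toContinuousLinearMap (a.2 ∘ₗ Φ.toLinearMap ∘ₗ LinearMap.inl ℝ T V))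
      map_add' := fun a b => by
        refine Prod.ext (by simp) ?_
        ext; simp
      map_smul' := fun c a => by
        refine Prod.ext (by simp) ?_
        ext; simp }
  { toFun := fun a =>
      (Φ ((J (h a)).1, P (Φ.symm a.1).2),
        ((J (h a)).2 : T →ₗ[ℝ] ℝ).coprod (-(a.2 ∘ₗ Φ.toLinearMap ∘ₗ LinearMap.inr ℝ T V ∘ₗ P)) ∘ₗ
          Φ.symm.toLinearMap)
    map_add' := fun a b => by
      refine Prod.ext ?_ ?_
      · simp only [map_add, Prod.fst_add, Prod.snd_add]
        rw [← Prod.mk_add_mk, map_add Φ]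
      · ext w
        simp
        ring
    map_smul' := fun c a => by
      refine Prod.ext ?_ ?_
      · simp only [map_smul, Prod.smul_fst, Prod.smul_snd, RingHom.id_apply]
        rw [← Prod.smul_mk, map_smul Φ]
      · ext w
        simp
        ring }

end Linear

section Model
variable {F : Type*} [NormedAddCommGroup F] [NormedSpace ℝ F] 

/-- A smooth local square root near `1` in a Banach algebra. -/
theorem exists_sqrt {A : Type*} [NormedRing A] [NormedAlgebra ℝ A] [CompleteSpace A] :
    ∃ r : A → A, ContDiffAt ℝ ∞ r 1 ∧ r 1 = 1 ∧ (∀ᶠ y in 𝓝 (1 : A), r y * r y = y) ∧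
      ∀ᶠ x in 𝓝 (1 : A), r (x * x) = x := by
  have hc : ContDiffAt ℝ ∞ (fun x : A => x * x) 1 := contDiffAt_id.mul contDiffAt_id
  let e : A ≃L[ℝ] A := ContinuousLinearEquiv.smulLeft (Units.mk0 (2 : ℝ) two_ne_zero)
  have hd : HasFDerivAt (fun x : A => x * x) (e : A →L[ℝ] A) 1 := by
    have := (hasFDerivAt_id (𝕜 := ℝ) (1 : A)).mul' (hasFDerivAt_id (1 : A))
    refine this.congr_fderiv ?_
    ext v
    simp [e, Units.smul_def, two_smul]
  have h1 : (fun x : A => x * x) 1 = 1 := by simp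
  have hs := hc.hasStrictFDerivAt' hd (by simp)
  refine ⟨hc.localInverse hd (by simp), ?_, ?_, ?_, ?_⟩
  · have := hc.to_localInverse hd (by simp)
    simpa using this
  · have := hc.localInverse_apply_image hd (by simp)
    simpa using this
  · have := hs.eventually_right_inverse
    simp only [mul_one] at this
    exact this
  · exact hs.eventually_left_inverse


section Cayley
variable {A : Type*} [NormedRing A] [NormedAlgebra ℝ A] [CompleteSpace A]

theorem contDiffAt_inverse_curve {X : ℝ → A} (h0 : X 0 = 1) (hX : ContDiffAt ℝ ∞ X 0) :
    ContDiffAt ℝ ∞ (fun t => Ring.inverse (X t)) 0 := by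
  have : ContDiffAt ℝ ∞ Ring.inverse (X 0) := by
    rw [h0]; exact contDiffAt_ringInverse ℝ (1 : Aˣ)
  exact this.comp (0 : ℝ) hX

theorem hasDerivAt_inverse_curve {X : ℝ → A} {X' : A} (h0 : X 0 = 1) (hX : HasDerivAt X X' 0) :
    HasDerivAt (fun t => Ring.inverse (X t)) (-X') 0 := by
  have h := hasFDerivAt_ringInverse (𝕜 := ℝ) (1 : Aˣ)
  obtain ⟨L, hL, hL'⟩ : ∃ L : A →L[ℝ] A, HasFDerivAt Ring.inverse L 1 ∧ ∀ x, L x = -x :=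
    ⟨_, h, fun x => by simp⟩
  rw [← h0] at hL
  have := hL.comp_hasDerivAt (0 : ℝ) hX
  rw [hL'] at this
  exact this

theorem eventually_isUnit_curve {X : ℝ → A} (h0 : X 0 = 1) (hX : ContinuousAt X 0) :
    ∀ᶠ t in 𝓝 0, IsUnit (X t) := by
  have : ∀ᶠ y in 𝓝 (X 0), IsUnit y := by
    rw [h0]; exact Units.nhds (1 : Aˣ)
  exact hX.eventually this

/-- A curve through `f` with velocity `v`, made of conjugates of `f` by Cayley transforms. -/
theorem exists_cayley (f v : A) (hff : f * f = 1) (hac : v * f = -(f * v)) :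
    ∃ c P N : ℝ → A, ContDiffAt ℝ ∞ c 0 ∧ c 0 = f ∧ HasDerivAt c v 0 ∧
      (∀ t, P t = 1 + (t / 4) • (v * f)) ∧ (∀ t, N t = 1 - (t / 4) • (v * f)) ∧
      (∀ᶠ t in 𝓝 0, IsUnit (P t)) ∧ (∀ᶠ t in 𝓝 0, IsUnit (N t)) ∧
      (∀ t, c t = P t * Ring.inverse (N t) * (f * (N t * Ring.inverse (P t)))) := by
  set u : A := (1 / 4 : ℝ) • (v * f) with hu
  let P : ℝ → A := fun t => 1 + (t / 4) • (v * f)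
  let N : ℝ → A := fun t => 1 - (t / 4) • (v * f)
  have hP0 : P 0 = 1 := by simp [P]
  have hN0 : N 0 = 1 := by simp [N]
  have hPd : HasDerivAt P u 0 := by
    have := (((hasDerivAt_id (0 : ℝ)).div_const 4).smul_const (v * f)).const_add 1
    simpa [P, hu] using this
  have hNd : HasDerivAt N (-u) 0 := by
    have := (((hasDerivAt_id (0 : ℝ)).div_const 4).smul_const (v * f)).const_sub 1
    simpa [N, hu] using this
  have hPc : ContDiff ℝ ∞ P := by simp only [P]; fun_prop
  have hNc : ContDiff ℝ ∞ N := by simp only [N]; fun_prop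
  refine ⟨fun t => P t * Ring.inverse (N t) * (f * (N t * Ring.inverse (P t))), P, N, ?_, ?_, ?_,
    fun _ => rfl, fun _ => rfl, eventually_isUnit_curve hP0 hPc.continuous.continuousAt,
    eventually_isUnit_curve hN0 hNc.continuous.continuousAt, fun _ => rfl⟩
  · exact (hPc.contDiffAt.mul (contDiffAt_inverse_curve hN0 hNc.contDiffAt)).mul
      (contDiffAt_const.mul
        (hNc.contDiffAt.mul (contDiffAt_inverse_curve hP0 hPc.contDiffAt)))
  · simp [hP0, hN0]
  · have h1 := hPd.mul (hasDerivAt_inverse_curve hN0 hNd)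
    have h2 := hNd.mul (hasDerivAt_inverse_curve hP0 hPd)
    refine HasDerivAt.congr_deriv (h1.mul (h2.const_mul f)) ?_
    have : f * (v * f) = - v := by rw [hac, mul_neg, ← mul_assoc, hff, one_mul]
    simp only [Pi.mul_apply, hP0, hN0, Ring.inverse_one, mul_one, one_mul, neg_neg]
    simp only [hu, mul_add, add_mul, smul_mul_assoc, mul_smul_comm, mul_neg, mul_assoc,
      hff, this, mul_one]
    module

end Cayley

section Abs
variable {V : Type*} [NormedAddCommGroup V] [NormedSpace ℝ V] [FiniteDimensional ℝ V]

/-- A paracomplex endomorphism, skew for the form `β` and preserving the subspace `S`. -/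
structure IsModelPt (β : LinearMap.BilinForm ℝ V) (S : Submodule ℝ V) (f : V →L[ℝ] V) : Prop where
  sq : ∀ a, f (f a) = a
  skew : ∀ a b, β (f a) b + β a (f b) = 0
  pres : ∀ a ∈ S, f a ∈ S

theorem IsModelPt.conj {β : LinearMap.BilinForm ℝ V} {S S' : Submodule ℝ V}
    {f a b : V →L[ℝ] V} (hf : IsModelPt β S f)
    (hba : ∀ x, b (a x) = x) (hab : ∀ x, a (b x) = x)
    (ha : ∀ x y, β (a x) (a y) = β x y)
    (haS : ∀ u ∈ S, a u ∈ S') (hbS : ∀ u ∈ S', b u ∈ S) :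
    IsModelPt β S' (a ∘L f ∘L b) := by
  refine ⟨?_, ?_, ?_⟩
  · intro x
    simp [hba, hab, hf.sq]
  · intro x y
    have := hf.skew (b x) (b y)
    rw [← ha, ← ha (b x), hab, hab] at this
    simpa using this
  · intro u hu
    exact haS _ (hf.pres _ (hbS _ hu))

/-- Curves of such endomorphisms with prescribed velocity. -/
theorem exists_vertical_curve {β : LinearMap.BilinForm ℝ V} {S : Submodule ℝ V}
    {f v : V →L[ℝ] V} (hf : IsModelPt β S f)
    (hac : ∀ a, v (f a) + f (v a) = 0) (hsk : ∀ a b, β (v a) b + β a (v b) = 0)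
    (hpr : ∀ a ∈ S, v a ∈ S) :
    ∃ c : ℝ → V →L[ℝ] V, ContDiffAt ℝ ∞ c 0 ∧ c 0 = f ∧
      HasDerivAt c v 0 ∧ ∀ᶠ t in 𝓝 0, IsModelPt β S (c t) := by
  have : CompleteSpace V := FiniteDimensional.complete ℝ V
  have hff : f * f = 1 := ContinuousLinearMap.ext hf.sq
  have hac' : v * f = -(f * v) := ContinuousLinearMap.ext fun a => eq_neg_of_add_eq_zero_left (hac a)
  obtain ⟨c, P, N, hc, hc0, hcd, hP, hN, hPu, hNu, hct⟩ := exists_cayley f v hff hac'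
  refine ⟨c, hc, hc0, hcd, ?_⟩
  filter_upwards [hPu, hNu] with t h1 h2
  have e1 : P t * Ring.inverse (P t) = 1 := Ring.mul_inverse_cancel _ h1
  have e1' : Ring.inverse (P t) * P t = 1 := Ring.inverse_mul_cancel _ h1
  have e2 : N t * Ring.inverse (N t) = 1 := Ring.mul_inverse_cancel _ h2
  have e2' : Ring.inverse (N t) * N t = 1 := Ring.inverse_mul_cancel _ h2
  have hPx : ∀ x, P t x = x + (t / 4) • v (f x) := fun x => by rw [hP]; simp
  have hNx : ∀ x, N t x = x - (t / 4) • v (f x) := fun x => by rw [hN]; simp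
  have husk : ∀ a b, β (v (f a)) b + β a (v (f b)) = 0 := by
    intro a b
    have h1 := hsk (f a) b
    have h2 := hf.skew a (v b)
    have h3 : v (f b) = -(f (v b)) := eq_neg_of_add_eq_zero_left (hac b)
    rw [h3, map_neg]
    linarith
  have hPN : ∀ x y, β (P t x) (P t y) = β (N t x) (N t y) := by
    intro x y
    have := husk x y
    simp only [hPx, hNx, map_add, map_sub, map_smul, LinearMap.add_apply,
      LinearMap.sub_apply, LinearMap.smul_apply, smul_eq_mul]
    linear_combination (t / 2) * this
  have hu : ∀ a ∈ S, v (f a) ∈ S := fun a ha => hpr _ (hf.pres _ ha)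
  have hPS : ∀ a ∈ S, P t a ∈ S := fun a ha => by
    rw [hPx]; exact S.add_mem ha (S.smul_mem _ (hu a ha))
  have hNS : ∀ a ∈ S, N t a ∈ S := fun a ha => by
    rw [hNx]; exact S.sub_mem ha (S.smul_mem _ (hu a ha))
  have hinvS : ∀ X : V →L[ℝ] V, Ring.inverse X * X = 1 → X * Ring.inverse X = 1 →
      (∀ a ∈ S, X a ∈ S) → ∀ a ∈ S, Ring.inverse X a ∈ S := by
    intro X hX hX' hXS a ha
    let X' : S →ₗ[ℝ] S := (X : V →ₗ[ℝ] V).restrict hXS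
    have hinj : Function.Injective X' := by
      intro x y hxy
      have h := congrArg (fun z : S => Ring.inverse X (z : V)) hxy
      have hx : ∀ z : V, Ring.inverse X (X z) = z := fun z => congrArg (fun g => g z) hX
      apply Subtype.ext
      simpa [X', LinearMap.restrict_apply, hx] using h
    obtain ⟨b, hb⟩ := (LinearMap.injective_iff_surjective.1 hinj) ⟨a, ha⟩
    have : X b = a := congrArg Subtype.val hb
    have hx : ∀ z : V, Ring.inverse X (X z) = z := fun z => congrArg (fun g => g z) hX
    rw [← this, hx]; exact b.2
  have hx1 : ∀ z : V, Ring.inverse (P t) (P t z) = z := fun z => congrArg (fun g => g z) e1'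
  have hx2 : ∀ z : V, P t (Ring.inverse (P t) z) = z := fun z => congrArg (fun g => g z) e1
  have hx3 : ∀ z : V, Ring.inverse (N t) (N t z) = z := fun z => congrArg (fun g => g z) e2'
  have hx4 : ∀ z : V, N t (Ring.inverse (N t) z) = z := fun z => congrArg (fun g => g z) e2
  rw [hct]
  refine hf.conj (a := P t * Ring.inverse (N t)) (b := N t * Ring.inverse (P t)) ?_ ?_ ?_ ?_ ?_
  · intro x; simp [hx1, hx4]
  · intro x; simp [hx2, hx3]
  · intro x y; simp [hPN, hx4]
  · intro x hx; exact hPS _ (hinvS _ e2' e2 hNS _ hx)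
  · intro x hx; exact hNS _ (hinvS _ e1' e1 hPS _ hx)

end Abs

section Pairing

/-- The neutral metric `⟨X + α, Y + β⟩ = (α(Y) + β(X)) / 2` on `T ⊕ T*`. -/
def pairing (T : Type*) [AddCommGroup T] [Module ℝ T] [TopologicalSpace T] :
    LinearMap.BilinForm ℝ (T × (T →L[ℝ] ℝ)) :=
  LinearMap.mk₂ ℝ (fun a b => (1 / 2 : ℝ) * (a.2 b.1 + b.2 a.1))
    (by intros; simp; ring) (by intros; simp; ring) (by intros; simp; ring)
    (by intros; simp; ring)

theorem pairing_apply {T : Type*} [AddCommGroup T] [Module ℝ T] [TopologicalSpace T]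
    (a b : T × (T →L[ℝ] ℝ)) : pairing T a b = (1 / 2) * (a.2 b.1 + b.2 a.1) := rfl

/-- The subspace `{X + q(X)}` of `T ⊕ T*`. -/
def graph {T : Type*} [AddCommGroup T] [Module ℝ T] [TopologicalSpace T]
    (q : T →L[ℝ] T →L[ℝ] ℝ) : Submodule ℝ (T × (T →L[ℝ] ℝ)) :=
  LinearMap.graph (q : T →ₗ[ℝ] T →L[ℝ] ℝ)

theorem mem_graph {T : Type*} [AddCommGroup T] [Module ℝ T] [TopologicalSpace T]
    {q : T →L[ℝ] T →L[ℝ] ℝ} {a : T × (T →L[ℝ] ℝ)} :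
    a ∈ graph q ↔ a.2 = q a.1 := by
  simp [graph, LinearMap.mem_graph_iff]

end Pairing

section Gauge

theorem contDiff_flip {X Y Z : Type*} [NormedAddCommGroup X] [NormedSpace ℝ X]
    [NormedAddCommGroup Y] [NormedSpace ℝ Y] [NormedAddCommGroup Z] [NormedSpace ℝ Z] :
    ContDiff ℝ ∞ (fun f : X →L[ℝ] Y →L[ℝ] Z => f.flip) := by
  have : IsBoundedLinearMap ℝ (fun f : X →L[ℝ] Y →L[ℝ] Z => f.flip) :=
    ⟨⟨fun _ _ => rfl, fun _ _ => rfl⟩, 1, one_pos, fun f => by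
      rw [one_mul, ContinuousLinearMap.opNorm_flip]⟩
  exact this.contDiff

theorem contDiff_precomp {X Y Z : Type*} [NormedAddCommGroup X] [NormedSpace ℝ X]
    [NormedAddCommGroup Y] [NormedSpace ℝ Y] [NormedAddCommGroup Z] [NormedSpace ℝ Z] :
    ContDiff ℝ ∞ (fun a : X →L[ℝ] Y => (ContinuousLinearMap.compL ℝ X Y Z).flip a) := by fun_prop

variable {F : Type*} [NormedAddCommGroup F] [NormedSpace ℝ F] [FiniteDimensional ℝ F]

/-- A smooth curve of isometries between the metrics of a smooth curve. -/
theorem exists_metric_gauge {g : ℝ → F →L[ℝ] F →L[ℝ] ℝ} (hg : ContDiffAt ℝ ∞ g 0)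
    (hsymm : ∀ᶠ t in 𝓝 0, ∀ u v, g t u v = g t v u) (hnd : ∀ u, (∀ v, g 0 u v = 0) → u = 0) :
    ∃ h k : ℝ → F →L[ℝ] F, ContDiffAt ℝ ∞ h 0 ∧ ContDiffAt ℝ ∞ k 0 ∧ h 0 = 1 ∧ k 0 = 1 ∧
      ∀ᶠ t in 𝓝 0, (∀ u, h t (k t u) = u) ∧ (∀ u, k t (h t u) = u) ∧
        ∀ u v, g t (h t u) (h t v) = g 0 u v := by
  have : CompleteSpace F := FiniteDimensional.complete ℝ F
  have hs0 : ∀ u v, g 0 u v = g 0 v u := hsymm.self_of_nhds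
  -- the metric at `0` as an isomorphism
  have hinj : Function.Injective (g 0) := by
    rw [injective_iff_map_eq_zero]
    intro u hu
    exact hnd u fun v => by rw [hu]; rfl
  have hfr : Module.finrank ℝ F = Module.finrank ℝ (F →L[ℝ] ℝ) := by
    rw [← (LinearMap.toContinuousLinearMap (𝕜 := ℝ) (E := F) (F' := ℝ)).finrank_eq]
    exact (Subspace.dual_finrank_eq (K := ℝ) (V := F)).symm
  let e : F ≃L[ℝ] (F →L[ℝ] ℝ) :=
    (LinearEquiv.ofInjectiveOfFinrankEq ((g 0 : F →L[ℝ] F →L[ℝ] ℝ) : F →ₗ[ℝ] F →L[ℝ] ℝ) hinj hfr).toContinuousLinearEquiv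
  have he : ∀ u, e u = g 0 u := fun u => rfl
  let s : ℝ → F →L[ℝ] F := fun t => (e.symm : (F →L[ℝ] ℝ) →L[ℝ] F) ∘L g t
  have hsd : ContDiffAt ℝ ∞ s 0 := contDiffAt_const.clm_comp hg
  have hs : ∀ t u v, g 0 (s t u) v = g t u v := by
    intro t u v
    rw [← he]; simp [s]
  have hs01 : s 0 = 1 := by
    ext u; apply hinj; ext v; rw [hs]; rfl
  -- the adjoint with respect to `g 0`
  let adj : (F →L[ℝ] F) → (F →L[ℝ] F) := fun a =>
    (e.symm : (F →L[ℝ] ℝ) →L[ℝ] F) ∘L ((ContinuousLinearMap.compL ℝ F F ℝ).flip a ∘L (e : F →L[ℝ] F →L[ℝ] ℝ))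
  have hadj : ∀ a u v, g 0 (adj a u) v = g 0 u (a v) := by
    intro a u v
    rw [← he, ← he]; simp [adj]
  have hadj' : ∀ a u v, g 0 u (adj a v) = g 0 (a u) v := by
    intro a u v; rw [hs0, hadj, hs0]
  have huniq : ∀ a b : F →L[ℝ] F, (∀ u v, g 0 (a u) v = g 0 (b u) v) → a = b := by
    intro a b hab
    ext u; apply hinj; ext v; exact hab u v
  have hadjc : Continuous adj := by
    simp only [adj]; fun_prop
  have hadj1 : adj 1 = 1 := huniq _ _ fun u v => by rw [hadj]; rfl
  have hadjmul : ∀ a b, adj (a * b) = adj b * adj a := fun a b => huniq _ _ fun u v => by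
    simp [hadj]
  obtain ⟨r, hrc, hr1, hrr, hru⟩ := exists_sqrt (A := F →L[ℝ] F)
  have hrs : ContDiffAt ℝ ∞ (fun t => r (s t)) 0 := by
    have : ContDiffAt ℝ ∞ r (s 0) := by rw [hs01]; exact hrc
    exact this.comp (0 : ℝ) hsd
  have hrs0 : r (s 0) = 1 := by rw [hs01, hr1]
  refine ⟨fun t => Ring.inverse (r (s t)), fun t => r (s t),
    contDiffAt_inverse_curve hrs0 hrs, hrs, by simp [hrs0], hrs0, ?_⟩
  have hst : Tendsto s (𝓝 0) (𝓝 1) := by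
    have := hsd.continuousAt.tendsto; rwa [hs01] at this
  have hrt : Tendsto (fun t => r (s t)) (𝓝 0) (𝓝 1) := by
    have := hrs.continuousAt.tendsto; rwa [hrs0] at this
  have hart : Tendsto (fun t => adj (r (s t))) (𝓝 0) (𝓝 1) := by
    have := (hadjc.tendsto 1).comp hrt; rwa [hadj1] at this
  filter_upwards [hsymm, hst.eventually hrr, hrt.eventually hru, hart.eventually hru,
    eventually_isUnit_curve hrs0 hrs.continuousAt] with t h1 h2 h3 h4 h5
  have hself : adj (s t) = s t := huniq _ _ fun u v => by
    rw [hadj, hs0, hs, hs, h1]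
  have hsa : adj (r (s t)) = r (s t) := by
    rw [← h4, ← hadjmul, h2, hself]
  have e1 : ∀ u, r (s t) (Ring.inverse (r (s t)) u) = u :=
    fun u => congrArg (fun g => g u) (Ring.mul_inverse_cancel _ h5)
  have e2 : ∀ u, Ring.inverse (r (s t)) (r (s t) u) = u :=
    fun u => congrArg (fun g => g u) (Ring.inverse_mul_cancel _ h5)
  refine ⟨e2, e1, fun u v => ?_⟩
  have h6 : ∀ u, s t u = r (s t) (r (s t) u) := fun u => congrArg (fun g => g u) h2.symm
  rw [← hs, h6, e1]
  have h7 := hadj (r (s t)) u (Ring.inverse (r (s t)) v)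
  rwa [hsa, e1] at h7

/-- A smooth curve of isometries of the pairing between the graphs of a smooth curve of forms. -/
theorem exists_horizontal_curve {q : ℝ → F →L[ℝ] F →L[ℝ] ℝ} (hq : ContDiffAt ℝ ∞ q 0)
    (hnd : ∀ u, (∀ v, q 0 u v + q 0 v u = 0) → u = 0)
    {f : (F × (F →L[ℝ] ℝ)) →L[ℝ] (F × (F →L[ℝ] ℝ))} (hf : IsModelPt (pairing F) (graph (q 0)) f) :
    ∃ c : ℝ → (F × (F →L[ℝ] ℝ)) →L[ℝ] (F × (F →L[ℝ] ℝ)), ContDiffAt ℝ ∞ c 0 ∧ c 0 = f ∧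
      ∀ᶠ t in 𝓝 0, IsModelPt (pairing F) (graph (q t)) (c t) := by
  let g : ℝ → F →L[ℝ] F →L[ℝ] ℝ := fun t => q t + (q t).flip
  let w : ℝ → F →L[ℝ] F →L[ℝ] ℝ := fun t => (1 / 2 : ℝ) • (q t - (q t).flip)
  have hflip : ContDiffAt ℝ ∞ (fun t => (q t).flip) 0 := contDiff_flip.contDiffAt.comp (0 : ℝ) hq
  have hg : ContDiffAt ℝ ∞ g 0 := hq.add hflip
  have hw : ContDiffAt ℝ ∞ w 0 := (hq.sub hflip).const_smul _
  obtain ⟨h, k, hh, hk, hh0, hk0, hhk⟩ := exists_metric_gauge hg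
    (Eventually.of_forall fun t u v => by simp [g, add_comm]) (fun u hu => hnd u (by simpa [g] using hu))
  let pre : (F →L[ℝ] F) →L[ℝ] (F →L[ℝ] ℝ) →L[ℝ] (F →L[ℝ] ℝ) := (ContinuousLinearMap.compL ℝ F F ℝ).flip
  have hpre : ∀ a (α : F →L[ℝ] ℝ), pre a α = α ∘L a := fun a α => rfl
  let A : (F →L[ℝ] F) → (F →L[ℝ] F) → (F →L[ℝ] F →L[ℝ] ℝ) → (F →L[ℝ] F →L[ℝ] ℝ) →
      (F × (F →L[ℝ] ℝ)) →L[ℝ] (F × (F →L[ℝ] ℝ)) := fun a b w1 w0 =>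
    ContinuousLinearMap.inl ℝ F (F →L[ℝ] ℝ) ∘L (a ∘L ContinuousLinearMap.fst ℝ F (F →L[ℝ] ℝ)) +
    ContinuousLinearMap.inr ℝ F (F →L[ℝ] ℝ) ∘L ((pre b ∘L (ContinuousLinearMap.snd ℝ F (F →L[ℝ] ℝ)
      - w0 ∘L ContinuousLinearMap.fst ℝ F (F →L[ℝ] ℝ))) + w1 ∘L (a ∘L ContinuousLinearMap.fst ℝ F (F →L[ℝ] ℝ)))
  have hA1 : ∀ a b w1 w0 x, (A a b w1 w0 x).1 = a x.1 := by intros; simp [A]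
  have hA2 : ∀ a b w1 w0 x v, (A a b w1 w0 x).2 v = x.2 (b v) - w0 x.1 (b v) + w1 (a x.1) v := by
    intros; simp [A, hpre]
  refine ⟨fun t => A (h t) (k t) (w t) (w 0) ∘L (f ∘L A (k t) (h t) (w 0) (w t)), ?_, ?_, ?_⟩
  · have hpreh : ContDiffAt ℝ ∞ (fun t => pre (h t)) 0 := contDiff_precomp.contDiffAt.comp (0 : ℝ) hh
    have hprek : ContDiffAt ℝ ∞ (fun t => pre (k t)) 0 := contDiff_precomp.contDiffAt.comp (0 : ℝ) hk
    have c1 : ContDiffAt ℝ ∞ (fun t => A (h t) (k t) (w t) (w 0)) 0 :=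
      (contDiffAt_const.clm_comp (hh.clm_comp contDiffAt_const)).add
        (contDiffAt_const.clm_comp ((hprek.clm_comp contDiffAt_const).add
          (hw.clm_comp (hh.clm_comp contDiffAt_const))))
    have c2 : ContDiffAt ℝ ∞ (fun t => A (k t) (h t) (w 0) (w t)) 0 :=
      (contDiffAt_const.clm_comp (hk.clm_comp contDiffAt_const)).add
        (contDiffAt_const.clm_comp ((hpreh.clm_comp (contDiffAt_const.sub
          (hw.clm_comp contDiffAt_const))).add
          (contDiffAt_const.clm_comp (hk.clm_comp contDiffAt_const))))
    exact c1.clm_comp (contDiffAt_const.clm_comp c2)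
  · have : A 1 1 (w 0) (w 0) = ContinuousLinearMap.id ℝ _ := by
      refine ContinuousLinearMap.ext fun x => Prod.ext ?_ (ContinuousLinearMap.ext fun v => ?_)
      · rw [hA1]; rfl
      · rw [hA2]; simp
    simp only [hh0, hk0, this]
    rfl
  · filter_upwards [hhk] with t ⟨h1, h2, h3⟩
    have hgen : ∀ (a b : F →L[ℝ] F) (t t' : ℝ), (∀ u, a (b u) = u) → (∀ u, b (a u) = u) →
        (∀ u v, g t (a u) (a v) = g t' u v) →
        (∀ x, A b a (w t') (w t) (A a b (w t) (w t') x) = x) ∧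
        (∀ x y, pairing F (A a b (w t) (w t') x) (A a b (w t) (w t') y) = pairing F x y) ∧
        ∀ x ∈ graph (q t'), A a b (w t) (w t') x ∈ graph (q t) := by
      intro a b t t' hab hba hgt
      have hwa : ∀ t u v, w t u v + w t v u = 0 := by
        intro t u v; simp [w]; ring
      refine ⟨fun x => ?_, fun x y => ?_, fun x hx => ?_⟩
      · refine Prod.ext ?_ (ContinuousLinearMap.ext fun v => ?_)
        · rw [hA1, hA1, hba]
        · rw [hA2, hA1, hA2, hba, hba]; ring
      · rw [pairing_apply, pairing_apply, hA1, hA1, hA2, hA2, hba, hba]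
        linear_combination (1/2) * hwa t (a x.1) (a y.1) - (1/2) * hwa t' x.1 y.1
      · rw [mem_graph] at hx ⊢
        refine ContinuousLinearMap.ext fun v => ?_
        rw [hA2, hA1, hx]
        have h4 := hgt x.1 (b v)
        rw [hab] at h4
        simp [g] at h4
        simp [w]
        linarith
    have h3' : ∀ u v, g 0 (k t u) (k t v) = g t u v := fun u v => by rw [← h3, h1, h1]
    obtain ⟨a1, a2, a3⟩ := hgen (h t) (k t) t 0 h1 h2 h3
    obtain ⟨b1, b2, b3⟩ := hgen (k t) (h t) 0 t h2 h1 h3'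
    exact hf.conj a1 b1 a2 a3 b3

end Gauge

end Model

section Bundles
open Bundle Manifold

variable (F : Type*) [NormedAddCommGroup F] [NormedSpace ℝ F]

variable {M : Type*} [TopologicalSpace M] [ChartedSpace F M]

/-- The model of the fibres of `TM ⊕ T*M`. -/
abbrev GF : Type _ := F × (F →L[ℝ] ℝ)

/-- The model of the fibres of the endomorphism bundle of `TM ⊕ T*M`. -/
abbrev EndF : Type _ := GF F →L[ℝ] GF F

instance : NormedAddCommGroup (GF F) := Prod.normedAddCommGroup
instance : NormedSpace ℝ (GF F) := Prod.normedSpace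
instance : NormedAddCommGroup (EndF F) := ContinuousLinearMap.toNormedAddCommGroup
instance : NormedSpace ℝ (EndF F) := ContinuousLinearMap.toNormedSpace
instance : AddCommGroup (EndF F) := NormedAddCommGroup.toAddCommGroup

/-- The cotangent space `T_x* M`. -/
abbrev CT (x : M) : Type _ := TangentSpace 𝓘(ℝ, F) x →L[ℝ] ℝ

/-- The fibre `T_x M ⊕ T_x* M`. -/
abbrev GT (x : M) : Type _ := TangentSpace 𝓘(ℝ, F) x × CT F x

instance (x : M) : AddCommGroup (CT F x) := ContinuousLinearMap.addCommGroup
instance (x : M) : Module ℝ (CT F x) := ContinuousLinearMap.module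
instance (x : M) : AddCommGroup (GT F x) := Prod.instAddCommGroup
instance (x : M) : Module ℝ (GT F x) := Prod.instModule
instance (x : M) : IsTopologicalAddGroup (CT F x) := ContinuousLinearMap.topologicalAddGroup
instance (x : M) : ContinuousAdd (CT F x) := IsTopologicalAddGroup.toContinuousAdd
instance (x : M) : ContinuousSMul ℝ (CT F x) := ContinuousLinearMap.continuousSMul
instance (x : M) : IsTopologicalAddGroup (GT F x) := Prod.instIsTopologicalAddGroup
instance (x : M) : ContinuousAdd (GT F x) := IsTopologicalAddGroup.toContinuousAdd
instance (x : M) : ContinuousSMul ℝ (GT F x) := Prod.continuousSMul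
instance (x : M) : T2Space (TangentSpace 𝓘(ℝ, F) x) := inferInstanceAs (T2Space F)
instance [FiniteDimensional ℝ F] (x : M) : FiniteDimensional ℝ (TangentSpace 𝓘(ℝ, F) x) :=
  inferInstanceAs (FiniteDimensional ℝ F)
instance [FiniteDimensional ℝ F] (x : M) : FiniteDimensional ℝ (CT F x) :=
  inferInstanceAs (FiniteDimensional ℝ (F →L[ℝ] ℝ))

/-- The fibre of the endomorphism bundle of `TM ⊕ T*M`. -/
abbrev EndT (x : M) : Type _ := GT F x →L[ℝ] GT F x

instance (x : M) : AddCommGroup (EndT F x) := ContinuousLinearMap.addCommGroup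
instance (x : M) : Module ℝ (EndT F x) := ContinuousLinearMap.module

variable [IsManifold 𝓘(ℝ, F) ∞ M]

variable (M) in
/-- The total space of the endomorphism bundle of `TM ⊕ T*M`. -/
abbrev EndTot : Type _ := TotalSpace (EndF F) (fun x : M => EndT F x)

/-- The model with corners of the total space of the endomorphism bundle. -/
abbrev IE : ModelWithCorners ℝ (F × EndF F) (ModelProd F (EndF F)) := 𝓘(ℝ, F).prod 𝓘(ℝ, EndF F)

variable {F}

variable (F M) in
/-- A generalized metric of signature `(n, n)` on `M`, given by a smooth metric `g` of signature
`(n, n)` and a smooth `2`-form `Θ`, both viewed as maps `TM → T*M`. -/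
structure GeneralizedMetric (n : ℕ) where
  /-- The metric. -/
  g : ∀ x : M, TangentSpace 𝓘(ℝ, F) x →L[ℝ] CT F x
  /-- The `2`-form. -/
  Θ : ∀ x : M, TangentSpace 𝓘(ℝ, F) x →L[ℝ] CT F x
  smooth_g : ContMDiff 𝓘(ℝ, F) (𝓘(ℝ, F).prod 𝓘(ℝ, F →L[ℝ] F →L[ℝ] ℝ)) ∞
    (fun x => TotalSpace.mk' (F →L[ℝ] F →L[ℝ] ℝ)
      (E := fun x : M => TangentSpace 𝓘(ℝ, F) x →L[ℝ] CT F x) x (g x))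
  smooth_Θ : ContMDiff 𝓘(ℝ, F) (𝓘(ℝ, F).prod 𝓘(ℝ, F →L[ℝ] F →L[ℝ] ℝ)) ∞
    (fun x => TotalSpace.mk' (F →L[ℝ] F →L[ℝ] ℝ)
      (E := fun x : M => TangentSpace 𝓘(ℝ, F) x →L[ℝ] CT F x) x (Θ x))
  symm : ∀ x u v, g x u v = g x v u
  alt : ∀ x u, Θ x u u = 0
  /-- Existence of an orthonormal basis with `n` vectors of square `1` and `n` of square `-1`. -/
  signature : ∀ x, ∃ b : Module.Basis (Fin n ⊕ Fin n) ℝ (TangentSpace 𝓘(ℝ, F) x),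
    (∀ i j, i ≠ j → g x (b i) (b j) = 0) ∧ (∀ i, g x (b (Sum.inl i)) (b (Sum.inl i)) = 1) ∧
      ∀ i, g x (b (Sum.inr i)) (b (Sum.inr i)) = -1

/-- The neutral metric on the fibre `T_x M ⊕ T_x* M`. -/
abbrev pair (x : M) : LinearMap.BilinForm ℝ (GT F x) := pairing (TangentSpace 𝓘(ℝ, F) x)

namespace GeneralizedMetric

variable {n : ℕ} (𝔤 : GeneralizedMetric F M n)

/-- `E' = E = {X + g(X) + Θ(X)}`. -/
def E (x : M) : Submodule ℝ (GT F x) := graph (𝔤.g x + 𝔤.Θ x)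

/-- `E'' = E^⊥`. -/
def Eperp (x : M) : Submodule ℝ (GT F x) := (pair x).orthogonal (𝔤.E x)

/-- Generalized paracomplex structures on the vector space `T_x M`: product structures on
`T_x M ⊕ T_x* M` that are skew-symmetric for the neutral metric. -/
structure _root_.GenReflector.IsGenParacomplex (x : M) (K : EndT F x) : Prop where
  sq : ∀ a, K (K a) = a
  ne_id : K ≠ ContinuousLinearMap.id ℝ _
  ne_neg_id : K ≠ -ContinuousLinearMap.id ℝ _
  skew : ∀ a b, pair x (K a) b + pair x a (K b) = 0

/-- The generalized reflector space `𝒢`, a subset of the total space of the endomorphism bundle of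
`TM ⊕ T*M`: its fibre at `x` consists of the generalized paracomplex structures on `T_x M` that
preserve `E_x`. -/
def reflector : Set (EndTot F M) :=
  {K | IsGenParacomplex K.1 K.2 ∧ ∀ a ∈ 𝔤.E K.1, K.2 a ∈ 𝔤.E K.1}

/-- The tangent space of the reflector space at one of its points, spanned by
the velocities of the smooth curves in the reflector space. -/
def tangent (K : EndTot F M) : Submodule ℝ (TangentSpace (IE F) K) :=
  Submodule.span ℝ {w | ∃ γ : ℝ → EndTot F M, ContMDiffAt 𝓘(ℝ, ℝ) (IE F) ∞ γ 0 ∧ γ 0 = K ∧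
    (∀ᶠ t in 𝓝 0, γ t ∈ 𝔤.reflector) ∧ (mfderiv 𝓘(ℝ, ℝ) (IE F) γ 0 (1 : ℝ) : F × EndF F) = w}

/-- `D` is the direct sum of metric connections on `E'` and on `E''`: a smooth connection on
`TM ⊕ T*M = E' ⊕ E''` that preserves the neutral metric, the sections of `E'` and those of `E''`.
The value `D s x X` is `(D_X s)(x)`. -/
structure IsDirectSumConnection
    (D : CovariantDerivative 𝓘(ℝ, F) (GF F) (fun x : M => GT F x)) : Prop where
  smooth : CovariantDerivative.ContMDiffCovariantDerivative D ∞
  metric : ∀ (s t : ∀ x : M, GT F x) (x : M),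
    MDifferentiableAt 𝓘(ℝ, F) (𝓘(ℝ, F).prod 𝓘(ℝ, GF F)) (fun y => TotalSpace.mk' (GF F) y (s y)) x →
    MDifferentiableAt 𝓘(ℝ, F) (𝓘(ℝ, F).prod 𝓘(ℝ, GF F)) (fun y => TotalSpace.mk' (GF F) y (t y)) x →
    ∀ X : TangentSpace 𝓘(ℝ, F) x,
      mvfderiv 𝓘(ℝ, F) (fun y => pair y (s y) (t y)) x X =
        pair x (D s x X) (t x) + pair x (s x) (D t x X)
  preserves : ∀ (s : ∀ x : M, GT F x) (x : M),
    MDifferentiableAt 𝓘(ℝ, F) (𝓘(ℝ, F).prod 𝓘(ℝ, GF F)) (fun y => TotalSpace.mk' (GF F) y (s y)) x →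
    (∀ y, s y ∈ 𝔤.E y) → ∀ X : TangentSpace 𝓘(ℝ, F) x, D s x X ∈ 𝔤.E x
  preserves_perp : ∀ (s : ∀ x : M, GT F x) (x : M),
    MDifferentiableAt 𝓘(ℝ, F) (𝓘(ℝ, F).prod 𝓘(ℝ, GF F)) (fun y => TotalSpace.mk' (GF F) y (s y)) x →
    (∀ y, s y ∈ 𝔤.Eperp y) → ∀ X : TangentSpace 𝓘(ℝ, F) x, D s x X ∈ 𝔤.Eperp x

end GeneralizedMetric

end Bundles

section Coord
open Bundle Manifold
variable {F : Type*} [NormedAddCommGroup F] [NormedSpace ℝ F]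
variable {M : Type*} [TopologicalSpace M] [ChartedSpace F M] [IsManifold 𝓘(ℝ, F) ∞ M]

variable (F) in
/-- The trivialization of `TM ⊕ T*M` centered at `p`. -/
abbrev triv (p : M) := trivializationAt (GF F) (fun x : M => GT F x) p
variable (F) in
/-- The trivialization of `TM` centered at `p`. -/
abbrev ttriv (p : M) := trivializationAt F (TangentSpace 𝓘(ℝ, F) : M → Type _) p

theorem triv_base (p : M) : (triv F p).baseSet = (ttriv F p).baseSet := by
  simp [triv, ttriv]

theorem triv_apply (p x : M) (hx : x ∈ (triv F p).baseSet) (a : GT F x) :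
   (triv F p).continuousLinearMapAt ℝ x a = ((ttriv F p).continuousLinearMapAt ℝ x a.1, a.2 ∘L (ttriv F p).symmL ℝ x) := by
  have hx' := hx
  rw [triv_base] at hx'
  rw [Trivialization.continuousLinearMapAt_apply, Trivialization.coe_linearMapAt_of_mem _ hx,
    Trivialization.continuousLinearMapAt_apply, Trivialization.coe_linearMapAt_of_mem _ hx']
  refine Prod.ext rfl ?_
  refine ContinuousLinearMap.ext fun v => ?_
  exact DFunLike.congr_fun (Bundle.Trivial.continuousLinearMapAt_trivialization ℝ M ℝ x)
    (a.2 ((ttriv F p).symmL ℝ x v))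

theorem triv_end (p x : M) (K : EndT F x) :
   (trivializationAt (EndF F) (fun x : M => EndT F x) p ⟨x, K⟩).2 = (triv F p).continuousLinearMapAt ℝ x ∘L K ∘L (triv F p).symmL ℝ x := rfl

theorem triv_left {p x : M} (hx : x ∈ (triv F p).baseSet) (a : GT F x) :
    (triv F p).symmL ℝ x ((triv F p).continuousLinearMapAt ℝ x a) = a := 
  Trivialization.symmL_continuousLinearMapAt _ hx a
theorem triv_right {p x : M} (hx : x ∈ (triv F p).baseSet) (a : GF F) :
    (triv F p).continuousLinearMapAt ℝ x ((triv F p).symmL ℝ x a) = a := 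
  Trivialization.continuousLinearMapAt_symmL _ hx a
theorem ttriv_left {p x : M} (hx : x ∈ (triv F p).baseSet) (a : TangentSpace 𝓘(ℝ, F) x) :
    (ttriv F p).symmL ℝ x ((ttriv F p).continuousLinearMapAt ℝ x a) = a := 
  Trivialization.symmL_continuousLinearMapAt _ (triv_base (F := F) p ▸ hx) a
theorem ttriv_right {p x : M} (hx : x ∈ (triv F p).baseSet) (a : F) :
    (ttriv F p).continuousLinearMapAt ℝ x ((ttriv F p).symmL ℝ x a) = a := 
  Trivialization.continuousLinearMapAt_symmL _ (triv_base (F := F) p ▸ hx) a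

theorem mem_triv (p : M) : p ∈ (triv F p).baseSet := FiberBundle.mem_baseSet_trivializationAt' p

theorem pair_triv {p x : M} (hx : x ∈ (triv F p).baseSet) (a b : GT F x) :
    pairing F ((triv F p).continuousLinearMapAt ℝ x a) ((triv F p).continuousLinearMapAt ℝ x b) = pair x a b := by
  rw [triv_apply _ _ hx, triv_apply _ _ hx]
  simp only [pairing_apply, ContinuousLinearMap.comp_apply, ttriv_left hx]

variable {n : ℕ} (𝔤 : GeneralizedMetric F M n)

/-- The coordinate expression of `g + Θ`. -/
def formAt (p x : M) : F →L[ℝ] F →L[ℝ] ℝ := 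
  ContinuousLinearMap.inCoordinates F (TangentSpace 𝓘(ℝ, F) : M → Type _) (F →L[ℝ] ℝ) (fun x : M => CT F x) p x p x (𝔤.g x + 𝔤.Θ x)

theorem formAt_apply {p x : M} (hx : x ∈ (triv F p).baseSet) (u v : F) : formAt 𝔤 p x u v = (𝔤.g x + 𝔤.Θ x) ((ttriv F p).symmL ℝ x u) ((ttriv F p).symmL ℝ x v) := by
  have hx' := hx
  rw [triv_base] at hx'
  rw [formAt, ContinuousLinearMap.inCoordinates]
  have hx2 : x ∈ (trivializationAt (F →L[ℝ] ℝ) (fun x : M => CT F x) p).baseSet := by simpa using hx'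
  simp only [ContinuousLinearMap.comp_apply]
  rw [Trivialization.continuousLinearMapAt_apply, Trivialization.coe_linearMapAt_of_mem _ hx2]
  exact DFunLike.congr_fun (Bundle.Trivial.continuousLinearMapAt_trivialization ℝ M ℝ x)
    ((𝔤.g x + 𝔤.Θ x) ((ttriv F p).symmL ℝ x u) ((ttriv F p).symmL ℝ x v))

theorem contMDiffAt_formAt (p : M) : ContMDiffAt 𝓘(ℝ, F) 𝓘(ℝ, F →L[ℝ] F →L[ℝ] ℝ) ∞ (formAt 𝔤 p) p := by
  have h1 := ((contMDiffAt_hom_bundle _).1 (𝔤.smooth_g p)).2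
  have h2 := ((contMDiffAt_hom_bundle _).1 (𝔤.smooth_Θ p)).2
  refine (h1.add h2).congr_of_eventuallyEq (Eventually.of_forall fun x => ?_)
  simp [formAt, ContinuousLinearMap.inCoordinates]

theorem mem_E_triv {p x : M} (hx : x ∈ (triv F p).baseSet) (a : GT F x) :
    (triv F p).continuousLinearMapAt ℝ x a ∈ graph (formAt 𝔤 p x) ↔ a ∈ 𝔤.E x := by
  rw [GeneralizedMetric.E, mem_graph, mem_graph, triv_apply _ _ hx]
  constructor
  · intro h
    ext v
    have := congrArg (fun f => f ((ttriv F p).continuousLinearMapAt ℝ x v)) h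
    simpa only [ContinuousLinearMap.comp_apply, formAt_apply 𝔤 hx, ttriv_left hx] using this
  · intro h
    ext v
    simp only [ContinuousLinearMap.comp_apply, formAt_apply 𝔤 hx, ttriv_left hx, h]

theorem g_nondeg (x : M) (u : TangentSpace 𝓘(ℝ, F) x) (h : ∀ v, 𝔤.g x u v = 0) : u = 0 := by
  obtain ⟨b, h0, h1, h2⟩ := 𝔤.signature x
  have hu : ∀ i, b.repr u i = 0 := by
    intro i
    have h3 := h (b i)
    rw [← b.sum_repr u] at h3
    simp only [map_sum, map_smul, _root_.sum_apply, _root_.smul_apply] at h3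
    rw [Finset.sum_eq_single i (fun j _ hj => by simp [h0 j i hj]) (by simp)] at h3
    rcases i with i | i
    · simpa [h1] using h3
    · simpa [h2] using h3
  rw [← b.sum_repr u]
  simp [hu]

theorem Θ_swap (x : M) (u v : TangentSpace 𝓘(ℝ, F) x) : 𝔤.Θ x u v = - 𝔤.Θ x v u := by
  have := 𝔤.alt x (u + v)
  simp [𝔤.alt] at this
  linarith

theorem formAt_nondeg {p x : M} (hx : x ∈ (triv F p).baseSet) (u : F)
    (h : ∀ v, formAt 𝔤 p x u v + formAt 𝔤 p x v u = 0) : u = 0 := by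
  have : (ttriv F p).symmL ℝ x u = 0 := by
    refine g_nondeg 𝔤 x _ fun v => ?_
    have h1 := h ((ttriv F p).continuousLinearMapAt ℝ x v)
    rw [formAt_apply 𝔤 hx, formAt_apply 𝔤 hx, ttriv_left hx] at h1
    simp at h1
    rw [𝔤.symm x v, Θ_swap 𝔤 x v] at h1
    linarith
  rw [← ttriv_right hx u, this, map_zero]

theorem ne_of_skew (𝔤 : GeneralizedMetric F M n) (hn : 1 ≤ n) {x : M} (K : EndT F x) (c : ℝ)
    (hc : c ≠ 0) (h : ∀ a b, pair x (K a) b + pair x a (K b) = 0) : ¬ ∀ a, K a = c • a := by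
  intro hK
  obtain ⟨b, h0, h1, h2⟩ := 𝔤.signature x
  have := h (0, 𝔤.g x (b (Sum.inl ⟨0, hn⟩))) (b (Sum.inl ⟨0, hn⟩), 0)
  simp [pairing_apply, h1, hK] at this
  apply hc
  linarith

theorem reflector_triv {p : M} (hn : 1 ≤ n) {K : EndTot F M} (hx : K.1 ∈ (triv F p).baseSet) :
    K ∈ 𝔤.reflector ↔ IsModelPt (pairing F) (graph (formAt 𝔤 p K.1))
      (trivializationAt (EndF F) (fun x : M => EndT F x) p K).2 := by
  obtain ⟨x, K⟩ := K
  rw [triv_end]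
  simp only at hx
  constructor
  · rintro ⟨h, hE⟩
    refine ⟨fun a => ?_, fun a b => ?_, fun a ha => ?_⟩
    · simp only [ContinuousLinearMap.comp_apply, triv_left hx]
      rw [h.sq, triv_right hx]
    · have := h.skew ((triv F p).symmL ℝ x a) ((triv F p).symmL ℝ x b)
      rw [← pair_triv hx, ← pair_triv hx, triv_right hx, triv_right hx] at this
      exact this
    · have : (triv F p).symmL ℝ x a ∈ 𝔤.E x := by
        rw [← mem_E_triv 𝔤 hx, triv_right hx]; exact ha
      exact (mem_E_triv 𝔤 hx _).2 (hE _ this)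
  · intro h
    have hsk : ∀ a b, pair x (K a) b + pair x a (K b) = 0 := by
      intro a b
      have := h.skew ((triv F p).continuousLinearMapAt ℝ x a) ((triv F p).continuousLinearMapAt ℝ x b)
      simp only [ContinuousLinearMap.comp_apply, triv_left hx] at this
      rwa [pair_triv hx, pair_triv hx] at this
    refine ⟨⟨fun a => ?_, ?_, ?_, hsk⟩, fun a ha => ?_⟩
    · have := congrArg ((triv F p).symmL ℝ x) (h.sq ((triv F p).continuousLinearMapAt ℝ x a))
      simpa only [ContinuousLinearMap.comp_apply, triv_left hx] using this
    · intro hK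
      exact ne_of_skew 𝔤 hn K 1 one_ne_zero hsk fun a => by
        rw [one_smul]; exact DFunLike.congr_fun hK a
    · intro hK
      exact ne_of_skew 𝔤 hn K (-1) (by norm_num) hsk fun a =>
        (DFunLike.congr_fun hK a).trans (neg_one_smul ℝ a).symm
    · have := h.pres _ ((mem_E_triv 𝔤 hx _).2 ha)
      simp only [ContinuousLinearMap.comp_apply, triv_left hx] at this
      rwa [mem_E_triv 𝔤 hx] at this
end Coord

section Vel
open Bundle Manifold
variable {F : Type*} [NormedAddCommGroup F] [NormedSpace ℝ F]
variable {M : Type*} [TopologicalSpace M] [ChartedSpace F M] [IsManifold 𝓘(ℝ, F) ∞ M]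

theorem hasFDerivAt_of_hasMFDerivAt {W : Type*} [NormedAddCommGroup W] [NormedSpace ℝ W] {H : Type*}
    [TopologicalSpace H] {I : ModelWithCorners ℝ W H} {N : Type*} [TopologicalSpace N]
    [ChartedSpace H N] {x : ℝ → N} {L : ℝ →L[ℝ] W} (h : HasMFDerivAt 𝓘(ℝ, ℝ) I x 0 L) :
    HasFDerivAt (fun t => extChartAt I (x 0) (x t)) L 0 := by
  have h2 : HasFDerivWithinAt (fun t => extChartAt I (x 0) (x t)) L (Set.range 𝓘(ℝ, ℝ)) 0 := h.2
  rwa [modelWithCornersSelf_coe, Set.range_id, hasFDerivWithinAt_univ] at h2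

theorem velocity_aux {W : Type*} [NormedAddCommGroup W] [NormedSpace ℝ W] {V : M → Type*}
    [TopologicalSpace (TotalSpace W V)] [∀ x, TopologicalSpace (V x)] [FiberBundle W V]
    {γ : ℝ → TotalSpace W V} {L : ℝ →L[ℝ] F × W} {L' : ℝ →L[ℝ] F}
    (h : HasMFDerivAt 𝓘(ℝ, ℝ) (𝓘(ℝ, F).prod 𝓘(ℝ, W)) γ 0 L)
    (h' : HasMFDerivAt 𝓘(ℝ, ℝ) 𝓘(ℝ, F) (fun t => (γ t).proj) 0 L')
    (d2 : DifferentiableAt ℝ (fun t => (trivializationAt W V (γ 0).proj (γ t)).2) 0) :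
    L 1 = (L' 1, deriv (fun t => (trivializationAt W V (γ 0).proj (γ t)).2) 0) := by
  have h1 := hasFDerivAt_of_hasMFDerivAt h
  have h2 := hasFDerivAt_of_hasMFDerivAt h'
  have hev : ∀ᶠ t in 𝓝 (0 : ℝ), γ t ∈ (trivializationAt W V (γ 0).proj).source :=
    h.1.eventually ((trivializationAt W V (γ 0).proj).open_source.mem_nhds
      (by rw [Trivialization.mem_source]; exact FiberBundle.mem_baseSet_trivializationAt' _))
  have h3 : HasFDerivAt (fun t => extChartAt (𝓘(ℝ, F).prod 𝓘(ℝ, W)) (γ 0) (γ t))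
      (L'.prod (fderiv ℝ (fun t => (trivializationAt W V (γ 0).proj (γ t)).2) 0)) 0 := by
    refine (h2.prodMk d2.hasFDerivAt).congr_of_eventuallyEq ?_
    filter_upwards [hev] with t ht
    rw [FiberBundle.extChartAt]
    show (extChartAt 𝓘(ℝ, F) (γ 0).proj (trivializationAt W V (γ 0).proj (γ t)).1, _) = _
    rw [(trivializationAt W V (γ 0).proj).coe_fst ht]
    rfl
  rw [h1.unique h3]
  simp

variable (F) in
/-- The trivialization of the endomorphism bundle centered at `p`. -/
abbrev etriv (p : M) := trivializationAt (EndF F) (fun x : M => EndT F x) p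

set_option synthInstance.maxHeartbeats 200000 in
theorem velocity {γ : ℝ → EndTot F M} (h : ContMDiffAt 𝓘(ℝ, ℝ) (IE F) ∞ γ 0) :
    ContMDiffAt 𝓘(ℝ, ℝ) 𝓘(ℝ, F) ∞ (fun t => (γ t).proj) 0 ∧
    ContDiffAt ℝ ∞ (fun t => (etriv F (γ 0).proj (γ t)).2) 0 ∧
    (mfderiv 𝓘(ℝ, ℝ) (IE F) γ 0 (1 : ℝ) : F × EndF F) =
     ((mfderiv 𝓘(ℝ, ℝ) 𝓘(ℝ, F) (fun t => (γ t).proj) 0 (1 : ℝ) : F), 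
       deriv (fun t => (etriv F (γ 0).proj (γ t)).2) 0) := by
  have h' := contMDiffAt_totalSpace.1 h
  refine ⟨h'.1, h'.2.contDiffAt, ?_⟩
  exact velocity_aux (h.mdifferentiableAt (by simp)).hasMFDerivAt 
    (h'.1.mdifferentiableAt (by simp)).hasMFDerivAt (h'.2.contDiffAt.differentiableAt (by simp))

set_option synthInstance.maxHeartbeats 200000 in
/-- The curve in the endomorphism bundle with prescribed coordinates. -/
theorem exists_curve {p : M} {x : ℝ → M} {c : ℝ → EndF F} (hx : ContMDiffAt 𝓘(ℝ, ℝ) 𝓘(ℝ, F) ∞ x 0)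
    (hx0 : x 0 = p) (hc : ContDiffAt ℝ ∞ c 0) :
    ∃ γ : ℝ → EndTot F M, ContMDiffAt 𝓘(ℝ, ℝ) (IE F) ∞ γ 0 ∧ (∀ t, (γ t).proj = x t) ∧
      ∀ᶠ t in 𝓝 0, (γ t).proj ∈ (triv F p).baseSet ∧ (etriv F p (γ t)).2 = c t := by
  subst hx0
  let γ : ℝ → EndTot F M := fun t => ⟨x t, (triv F (x 0)).symmL ℝ (x t) ∘L c t ∘L (triv F (x 0)).continuousLinearMapAt ℝ (x t)⟩
  have hev : ∀ᶠ t in 𝓝 (0 : ℝ), x t ∈ (triv F (x 0)).baseSet :=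
    hx.continuousAt.eventually ((triv F (x 0)).open_baseSet.mem_nhds (mem_triv _))
  have hev2 : ∀ᶠ t in 𝓝 0, (γ t).proj ∈ (triv F (x 0)).baseSet ∧ (etriv F (x 0) (γ t)).2 = c t := by
    filter_upwards [hev] with t ht
    refine ⟨ht, ?_⟩
    rw [triv_end]
    refine ContinuousLinearMap.ext fun a => ?_
    simp only [ContinuousLinearMap.comp_apply]
    rw [triv_right ht, triv_right ht]
  refine ⟨γ, contMDiffAt_totalSpace.2 ⟨hx, ?_⟩, fun t => rfl, hev2⟩
  exact hc.contMDiffAt.congr_of_eventuallyEq (hev2.mono fun t ht => ht.2)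

theorem exists_base_curve (p : M) (X : TangentSpace 𝓘(ℝ, F) p) :
    ∃ x : ℝ → M, ContMDiffAt 𝓘(ℝ, ℝ) 𝓘(ℝ, F) ∞ x 0 ∧ x 0 = p ∧ 
      (mfderiv 𝓘(ℝ, ℝ) 𝓘(ℝ, F) x 0 (1 : ℝ) : F) = X := by
  obtain ⟨X, rfl⟩ : ∃ X' : F, X' = X := ⟨X, rfl⟩
  let y : ℝ → F := fun t => extChartAt 𝓘(ℝ, F) p p + t • X
  have hy : HasDerivAt y X 0 := by
    have := ((hasDerivAt_id (0 : ℝ)).smul_const X).const_add (extChartAt 𝓘(ℝ, F) p p)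
    simpa [y] using this
  have hy0 : y 0 = extChartAt 𝓘(ℝ, F) p p := by simp [y]
  have hys : ContDiff ℝ ∞ y := by simp only [y]; fun_prop
  have h1 : ContMDiffAt 𝓘(ℝ, F) 𝓘(ℝ, F) ∞ (extChartAt 𝓘(ℝ, F) p).symm (y 0) := by
    rw [hy0]
    exact (contMDiffOn_extChartAt_symm p).contMDiffAt (extChartAt_target_mem_nhds p)
  have h2 : ContMDiffAt 𝓘(ℝ, ℝ) 𝓘(ℝ, F) ∞ (fun t => (extChartAt 𝓘(ℝ, F) p).symm (y t)) 0 :=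
    h1.comp (0 : ℝ) hys.contMDiff.contMDiffAt
  have h0 : (extChartAt 𝓘(ℝ, F) p).symm (y 0) = p := by rw [hy0]; exact extChartAt_to_inv p
  refine ⟨_, h2, h0, ?_⟩
  have h3 := hasFDerivAt_of_hasMFDerivAt (h2.mdifferentiableAt (by simp)).hasMFDerivAt
  have hev : ∀ᶠ t in 𝓝 (0 : ℝ), y t ∈ (extChartAt 𝓘(ℝ, F) p).target :=
    hys.continuous.continuousAt.eventually (by rw [hy0]; exact extChartAt_target_mem_nhds p)
  rw [h0] at h3
  have h4 : HasFDerivAt (fun t => extChartAt 𝓘(ℝ, F) p ((extChartAt 𝓘(ℝ, F) p).symm (y t)))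
      (ContinuousLinearMap.toSpanSingleton ℝ X) 0 :=
    hy.hasFDerivAt.congr_of_eventuallyEq (hev.mono fun t ht => (extChartAt 𝓘(ℝ, F) p).right_inv ht)
  have h5 := congrArg (fun L : ℝ →L[ℝ] F => L 1) (h3.unique h4)
  simp only [ContinuousLinearMap.toSpanSingleton_apply, one_smul] at h5
  exact h5
end Vel

section Conn
open Bundle Manifold
variable {F : Type*} [NormedAddCommGroup F] [NormedSpace ℝ F]
variable {M : Type*} [TopologicalSpace M] [ChartedSpace F M] 
variable {W : Type*} [NormedAddCommGroup W] [NormedSpace ℝ W] {V : M → Type*}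
    [TopologicalSpace (TotalSpace W V)] [∀ x, TopologicalSpace (V x)] [∀ x, AddCommGroup (V x)]
    [∀ x, Module ℝ (V x)] [∀ x, IsTopologicalAddGroup (V x)] [∀ x, ContinuousSMul ℝ (V x)]
    [FiberBundle W V] [VectorBundle ℝ W V]

theorem mvfderiv_congr {U : Type*} [NormedAddCommGroup U] [NormedSpace ℝ U] {f g : M → U} {p : M}
    (h : f =ᶠ[𝓝 p] g) : mvfderiv 𝓘(ℝ, F) f p = mvfderiv 𝓘(ℝ, F) g p := by
  ext X
  have := h.mfderiv_eq (I := 𝓘(ℝ, F)) (I' := 𝓘(ℝ, U))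
  exact congrArg (fun L : F →L[ℝ] U => L X) this

variable (V) in
/-- The section which is constant in the trivialization at `p`. -/
def frameSec (p : M) (a : W) (x : M) : V x := (trivializationAt W V p).symmL ℝ x a

theorem frameSec_eventually (p : M) (a : W) : ∀ᶠ x in 𝓝 p,
    (trivializationAt W V p).continuousLinearMapAt ℝ x (frameSec V p a x) = a := by
  filter_upwards [(trivializationAt W V p).open_baseSet.mem_nhds
    (FiberBundle.mem_baseSet_trivializationAt' p)] with x hx
  exact Trivialization.continuousLinearMapAt_symmL _ hx a

theorem coord_eventually (p : M) (s : ∀ x, V x) : ∀ᶠ x in 𝓝 p,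
    (trivializationAt W V p).continuousLinearMapAt ℝ x (s x) = (trivializationAt W V p ⟨x, s x⟩).2 := by
  filter_upwards [(trivializationAt W V p).open_baseSet.mem_nhds
    (FiberBundle.mem_baseSet_trivializationAt' p)] with x hx
  rw [Trivialization.continuousLinearMapAt_apply, Trivialization.coe_linearMapAt_of_mem _ hx]

/-- Differentiability of a section at a point. -/
abbrev SecDiffAt (s : ∀ x, V x) (p : M) : Prop :=
  MDifferentiableAt 𝓘(ℝ, F) (𝓘(ℝ, F).prod 𝓘(ℝ, W)) (fun x => TotalSpace.mk' W x (s x)) p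

theorem secDiffAt_iff {s : ∀ x, V x} {p : M} : SecDiffAt (F := F) (W := W) s p ↔
    MDifferentiableAt 𝓘(ℝ, F) 𝓘(ℝ, W) (fun x => (trivializationAt W V p).continuousLinearMapAt ℝ x (s x)) p := by
  rw [SecDiffAt, mdifferentiableAt_section]
  exact ⟨fun h => h.congr_of_eventuallyEq (coord_eventually p s),
    fun h => h.congr_of_eventuallyEq ((coord_eventually p s).mono fun _ h => h.symm)⟩

theorem secDiffAt_frameSec (p : M) (a : W) : SecDiffAt (F := F) (W := W) (frameSec V p a) p :=
  secDiffAt_iff.2 (mdifferentiableAt_const.congr_of_eventuallyEq (frameSec_eventually p a))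

/-- The connection matrix `Γ(X)` of `D` at `p` in the trivialization centered at `p`, in which
`D_X s = ds(X) + Γ(X) s` at `p`. -/
def christoffel [FiniteDimensional ℝ W] (D : CovariantDerivative 𝓘(ℝ, F) W V) (p : M) (X : TangentSpace 𝓘(ℝ, F) p) :
    W →L[ℝ] W := LinearMap.toContinuousLinearMap
  { toFun := fun a => (trivializationAt W V p).continuousLinearMapAt ℝ p (D (frameSec V p a) p X)
    map_add' := fun a b => by
      have : frameSec V p (a + b) = frameSec V p a + frameSec V p b := by
        funext x; simp [frameSec]
      rw [this, D.isCovariantDerivativeOnUniv.add (secDiffAt_frameSec p a) (secDiffAt_frameSec p b)]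
      simp
    map_smul' := fun c a => by
      have : frameSec V p (c • a) = (fun _ : M => c) • frameSec V p a := by
        funext x; simp [frameSec]
      rw [this, D.isCovariantDerivativeOnUniv.leibniz (secDiffAt_frameSec p a) mdifferentiableAt_const]
      simp [mvfderiv_const] }

variable [FiniteDimensional ℝ W] (D : CovariantDerivative 𝓘(ℝ, F) W V)
theorem christoffel_apply (p : M) (X : TangentSpace 𝓘(ℝ, F) p) (a : W) :
    christoffel D p X a = (trivializationAt W V p).continuousLinearMapAt ℝ p (D (frameSec V p a) p X) := rfl

theorem christoffel_add (p : M) (X Y : TangentSpace 𝓘(ℝ, F) p) :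
    christoffel D p (X + Y) = christoffel D p X + christoffel D p Y := by
  ext a; simp [christoffel_apply]
theorem christoffel_smul (p : M) (c : ℝ) (X : TangentSpace 𝓘(ℝ, F) p) :
    christoffel D p (c • X) = c • christoffel D p X := by
  ext a; simp [christoffel_apply]

theorem conn_apply [IsManifold 𝓘(ℝ, F) 1 M] [ContMDiffVectorBundle 1 W V 𝓘(ℝ, F)] {s : ∀ x, V x} {p : M} (hs : SecDiffAt (F := F) (W := W) s p) (X : TangentSpace 𝓘(ℝ, F) p) :
    (trivializationAt W V p).continuousLinearMapAt ℝ p (D s p X) =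
      mvfderiv 𝓘(ℝ, F) (fun x => (trivializationAt W V p).continuousLinearMapAt ℝ x (s x)) p X +
        christoffel D p X ((trivializationAt W V p).continuousLinearMapAt ℝ p (s p)) := by
  let Φ : (∀ x, V x) → W := fun s => (trivializationAt W V p).continuousLinearMapAt ℝ p (D s p X) -
    mvfderiv 𝓘(ℝ, F) (fun x => (trivializationAt W V p).continuousLinearMapAt ℝ x (s x)) p X
  have hΦ : TensorialAt 𝓘(ℝ, F) W Φ p := by
    constructor
    · intro f σ hf hσ
      have h1 := mvfderiv_smul hf (secDiffAt_iff.1 hσ)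
      have h2 : (fun x => (trivializationAt W V p).continuousLinearMapAt ℝ x ((f • σ) x)) =
        f • fun x => (trivializationAt W V p).continuousLinearMapAt ℝ x (σ x) := by funext x; simp
      simp only [Φ]
      rw [h2, h1, D.isCovariantDerivativeOnUniv.leibniz hσ hf]
      simp [smul_sub]
    · intro σ τ hσ hτ
      have h1 := mvfderiv_add (secDiffAt_iff.1 hσ) (secDiffAt_iff.1 hτ)
      have h2 : (fun x => (trivializationAt W V p).continuousLinearMapAt ℝ x ((σ + τ) x)) =
        (fun x => (trivializationAt W V p).continuousLinearMapAt ℝ x (σ x)) + fun x => (trivializationAt W V p).continuousLinearMapAt ℝ x (τ x) := by funext x; simp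
      simp only [Φ]
      rw [h2, h1, D.isCovariantDerivativeOnUniv.add hσ hτ]
      simp
      abel
  have h := hΦ.pointwise hs (secDiffAt_frameSec p ((trivializationAt W V p).continuousLinearMapAt ℝ p (s p))) 
    (Trivialization.symmL_continuousLinearMapAt _ (FiberBundle.mem_baseSet_trivializationAt' p) _).symm
  simp only [Φ] at h
  rw [christoffel_apply, sub_eq_iff_eq_add.1 h, add_comm]
  have h0 : mvfderiv 𝓘(ℝ, F) (fun x => (trivializationAt W V p).continuousLinearMapAt ℝ x 
    (frameSec V p ((trivializationAt W V p).continuousLinearMapAt ℝ p (s p)) x)) p = 0 := by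
    rw [mvfderiv_congr (frameSec_eventually p _), mvfderiv_const]
  rw [h0]
  simp
end Conn

section Chr
open Bundle Manifold
variable {F : Type*} [NormedAddCommGroup F] [NormedSpace ℝ F]
variable {M : Type*} [TopologicalSpace M] [ChartedSpace F M] 

theorem mvfderiv_affine {U U' : Type*} [NormedAddCommGroup U] [NormedSpace ℝ U] [NormedAddCommGroup U'] [NormedSpace ℝ U']
    (c : U') (L : U →L[ℝ] U') {f : M → U} {p : M} (hf : MDifferentiableAt 𝓘(ℝ, F) 𝓘(ℝ, U) f p) :
    MDifferentiableAt 𝓘(ℝ, F) 𝓘(ℝ, U') (fun x => c + L (f x)) p ∧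
    ∀ X, mvfderiv 𝓘(ℝ, F) (fun x => c + L (f x)) p X = L (mvfderiv 𝓘(ℝ, F) f p X) := by
  have hg : HasFDerivAt (fun y => c + L y) L (f p) := L.hasFDerivAt.const_add c
  have h := hg.hasMFDerivAt.comp p hf.hasMFDerivAt
  refine ⟨h.mdifferentiableAt, fun X => ?_⟩
  have := h.mfderiv
  exact congrArg (fun L : F →L[ℝ] U' => L X) this

variable [IsManifold 𝓘(ℝ, F) ∞ M]
variable {n : ℕ} {𝔤 : GeneralizedMetric F M n} [FiniteDimensional ℝ F]
  {D : CovariantDerivative 𝓘(ℝ, F) (GF F) (fun x : M => GT F x)} 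

theorem christoffel_skew (hD : 𝔤.IsDirectSumConnection D) (p : M) (X : TangentSpace 𝓘(ℝ, F) p) (a b : GF F) :
    pairing F (christoffel D p X a) b + pairing F a (christoffel D p X b) = 0 := by
  have h := hD.metric (frameSec (fun x : M => GT F x) p a) (frameSec (fun x : M => GT F x) p b) p
    (secDiffAt_frameSec p a) (secDiffAt_frameSec p b) X
  have hev : (fun y => pair y (frameSec (fun x : M => GT F x) p a y) (frameSec (fun x : M => GT F x) p b y))
      =ᶠ[𝓝 p] fun _ => pairing F a b := by
    filter_upwards [(triv F p).open_baseSet.mem_nhds (mem_triv p)] with x hx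
    rw [← pair_triv hx]
    simp only [frameSec]
    rw [triv_right hx, triv_right hx]
  rw [mvfderiv_congr hev, mvfderiv_const, ← pair_triv (mem_triv p), ← pair_triv (mem_triv p)] at h
  simp only [frameSec] at h
  rw [triv_right (mem_triv p), triv_right (mem_triv p)] at h
  exact h.symm

set_option synthInstance.maxHeartbeats 200000 in
theorem christoffel_graph (hD : 𝔤.IsDirectSumConnection D) (p : M) (X : TangentSpace 𝓘(ℝ, F) p) (u : F) :
    ((0 : F), mvfderiv 𝓘(ℝ, F) (formAt 𝔤 p) p X u) + christoffel D p X (u, formAt 𝔤 p p u) ∈ graph (formAt 𝔤 p p) := by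
  let s : ∀ x : M, GT F x := fun x => (triv F p).symmL ℝ x (u, formAt 𝔤 p x u)
  have hsE : ∀ x, s x ∈ 𝔤.E x := by
    intro x
    by_cases hx : x ∈ (triv F p).baseSet
    · rw [← mem_E_triv 𝔤 hx]
      simp only [s]
      rw [triv_right hx, mem_graph]
    · have : s x = 0 := Trivialization.symmL_apply_of_notMem (triv F p) hx _
      rw [this]; exact Submodule.zero_mem _
  have hev : (fun x => (triv F p).continuousLinearMapAt ℝ x (s x)) =ᶠ[𝓝 p] fun x => 
      (u, (0 : F →L[ℝ] ℝ)) + (ContinuousLinearMap.inr ℝ F (F →L[ℝ] ℝ) ∘L (ContinuousLinearMap.apply ℝ (F →L[ℝ] ℝ) u)) (formAt 𝔤 p x) := by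
    filter_upwards [(triv F p).open_baseSet.mem_nhds (mem_triv p)] with x hx
    simp only [s]
    rw [triv_right hx]
    simp
  have hq := (contMDiffAt_formAt 𝔤 p).mdifferentiableAt (by simp)
  have ha := mvfderiv_affine (u, (0 : F →L[ℝ] ℝ)) (ContinuousLinearMap.inr ℝ F (F →L[ℝ] ℝ) ∘L (ContinuousLinearMap.apply ℝ (F →L[ℝ] ℝ) u)) hq
  have hs : SecDiffAt (F := F) (W := GF F) s p := by
    rw [secDiffAt_iff]
    exact ha.1.congr_of_eventuallyEq hev
  have h := conn_apply D hs X
  rw [mvfderiv_congr hev, ha.2 X] at h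
  have h2 := (mem_E_triv 𝔤 (mem_triv p) _).2 (hD.preserves s p hs hsE X)
  rw [h] at h2
  simp only [s] at h2
  rw [triv_right (mem_triv p)] at h2
  exact h2
end Chr

section Variation
variable {F : Type*} [NormedAddCommGroup F] [NormedSpace ℝ F] [FiniteDimensional ℝ F]

/-- The tangent vectors to the set of such endomorphisms. -/
structure IsModelTan {V : Type*} [NormedAddCommGroup V] [NormedSpace ℝ V]
    (β : LinearMap.BilinForm ℝ V) (S : Submodule ℝ V) (f v : V →L[ℝ] V) : Prop where
  anti : ∀ a, v (f a) + f (v a) = 0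
  skew : ∀ a b, β (v a) b + β a (v b) = 0
  pres : ∀ a ∈ S, v a ∈ S

theorem isModelTan_of_curve {q : ℝ → F →L[ℝ] F →L[ℝ] ℝ} {Q' : F →L[ℝ] F →L[ℝ] ℝ}
    (hq : HasDerivAt q Q' 0)
    {f : ℝ → (F × (F →L[ℝ] ℝ)) →L[ℝ] (F × (F →L[ℝ] ℝ))} 
    {f' Γ : (F × (F →L[ℝ] ℝ)) →L[ℝ] (F × (F →L[ℝ] ℝ))} (hf : HasDerivAt f f' 0)
    (h : ∀ᶠ t in 𝓝 0, IsModelPt (pairing F) (graph (q t)) (f t))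
    (hΓ : ∀ a b, pairing F (Γ a) b + pairing F a (Γ b) = 0)
    (hΓ' : ∀ u, ((0 : F), Q' u) + Γ (u, q 0 u) ∈ graph (q 0)) :
    IsModelTan (pairing F) (graph (q 0)) (f 0) (f' + (Γ ∘L f 0 - f 0 ∘L Γ)) := by
  have h0 := h.self_of_nhds
  have hfa : ∀ a, HasDerivAt (fun t => f t a) (f' a) 0 := fun a => by
    simpa using hf.clm_apply (hasDerivAt_const (0 : ℝ) a)
  refine ⟨fun a => ?_, fun a b => ?_, fun a ha => ?_⟩
  · have h1 : HasDerivAt (fun t => f t (f t a)) (f' (f 0 a) + f 0 (f' a)) 0 := hf.clm_apply (hfa a)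
    have h2 : HasDerivAt (fun t => f t (f t a)) 0 0 :=
      (hasDerivAt_const (0 : ℝ) a).congr_of_eventuallyEq (h.mono fun t ht => ht.sq a)
    have h3 := h1.unique h2
    simp only [_root_.add_apply, _root_.sub_apply, ContinuousLinearMap.comp_apply, map_add, map_sub, h0.sq]
    rw [← h3]; abel
  · let l1 : (F × (F →L[ℝ] ℝ)) →L[ℝ] ℝ := LinearMap.toContinuousLinearMap ((pairing F).flip b)
    let l2 : (F × (F →L[ℝ] ℝ)) →L[ℝ] ℝ := LinearMap.toContinuousLinearMap (pairing F a)
    have h1 : HasDerivAt (fun t => l1 (f t a) + l2 (f t b)) (l1 (f' a) + l2 (f' b)) 0 :=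
      (l1.hasFDerivAt.comp_hasDerivAt (0 : ℝ) (hfa a)).add (l2.hasFDerivAt.comp_hasDerivAt (0 : ℝ) (hfa b))
    have h2 : HasDerivAt (fun t => l1 (f t a) + l2 (f t b)) 0 0 :=
      (hasDerivAt_const (0 : ℝ) (0 : ℝ)).congr_of_eventuallyEq (h.mono fun t ht => ht.skew a b)
    have h3 : pairing F (f' a) b + pairing F a (f' b) = 0 := h1.unique h2
    have h4 := hΓ (f 0 a) b
    have h5 := h0.skew a (Γ b)
    have h6 := h0.skew (Γ a) b
    have h7 := hΓ a (f 0 b)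
    simp only [_root_.add_apply, _root_.sub_apply, ContinuousLinearMap.comp_apply, map_add, map_sub,
      LinearMap.add_apply, LinearMap.sub_apply]
    linarith
  · obtain ⟨u, α⟩ := a
    rw [mem_graph] at ha
    simp only at ha
    subst ha
    have hqu : HasDerivAt (fun t => q t u) (Q' u) 0 := by
      simpa using hq.clm_apply (hasDerivAt_const (0 : ℝ) u)
    have hb : HasDerivAt (fun t => f t (u, q t u)) (f' (u, q 0 u) + f 0 (0, Q' u)) 0 :=
      hf.clm_apply ((hasDerivAt_const (0 : ℝ) u).prodMk hqu)
    have h1 : HasDerivAt (fun t => (f t (u, q t u)).2) (f' (u, q 0 u) + f 0 (0, Q' u)).2 0 :=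
      (ContinuousLinearMap.snd ℝ F (F →L[ℝ] ℝ)).hasFDerivAt.comp_hasDerivAt (0 : ℝ) hb
    have h2 : HasDerivAt (fun t => (f t (u, q t u)).1) (f' (u, q 0 u) + f 0 (0, Q' u)).1 0 :=
      (ContinuousLinearMap.fst ℝ F (F →L[ℝ] ℝ)).hasFDerivAt.comp_hasDerivAt (0 : ℝ) hb
    have h3 := hq.clm_apply h2
    have h4 := (h3.congr_of_eventuallyEq (h.mono fun t ht =>
      mem_graph.1 (ht.pres _ (mem_graph.2 (rfl : (u, q t u).2 = q t (u, q t u).1))))).unique h1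
    have h5 := mem_graph.1 (h0.pres _ (hΓ' u))
    have h6 := hΓ' (f 0 (u, q 0 u)).1
    rw [← mem_graph.1 (h0.pres _ (mem_graph.2 (rfl : (u, q 0 u).2 = q 0 (u, q 0 u).1)))] at h6
    have h6 := mem_graph.1 h6
    rw [mem_graph]
    simp only [_root_.add_apply, _root_.sub_apply, ContinuousLinearMap.comp_apply, map_add, map_sub,
      Prod.fst_add, Prod.snd_add, Prod.fst_sub, Prod.snd_sub, Prod.mk.eta, zero_add] at h4 h5 h6 ⊢
    ext v
    have h4 := DFunLike.congr_fun h4 v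
    have h5 := DFunLike.congr_fun h5 v
    have h6 := DFunLike.congr_fun h6 v
    simp only [_root_.add_apply, _root_.sub_apply] at h4 h5 h6 ⊢
    linarith
end Variation

section Splitting
open Bundle Manifold
variable {F : Type*} [NormedAddCommGroup F] [NormedSpace ℝ F]
variable {M : Type*} [TopologicalSpace M] [ChartedSpace F M] [IsManifold 𝓘(ℝ, F) ∞ M]

/-- The coordinate expression of an endomorphism of the fibre at `p` in the trivialization centered
at `p`. -/
def toModel (p : M) : EndT F p →ₗ[ℝ] EndF F where
  toFun V := (triv F p).continuousLinearMapAt ℝ p ∘L V ∘L (triv F p).symmL ℝ p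
  map_add' V W := by
    refine ContinuousLinearMap.ext fun a => ?_
    simp only [ContinuousLinearMap.comp_apply, _root_.add_apply, map_add]
  map_smul' c V := by
    refine ContinuousLinearMap.ext fun a => ?_
    simp only [ContinuousLinearMap.comp_apply, _root_.smul_apply, map_smul, RingHom.id_apply]

theorem toModel_apply (p : M) (V : EndT F p) (a : GF F) :
    toModel p V a = (triv F p).continuousLinearMapAt ℝ p (V ((triv F p).symmL ℝ p a)) := rfl

theorem toModel_injective (p : M) : Function.Injective (toModel (F := F) p) := by
  intro V W h
  refine ContinuousLinearMap.ext fun a => ?_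
  have := congrArg ((triv F p).symmL ℝ p) (DFunLike.congr_fun h ((triv F p).continuousLinearMapAt ℝ p a))
  rwa [toModel_apply, toModel_apply, triv_left (mem_triv p), triv_left (mem_triv p),
    triv_left (mem_triv p)] at this

theorem toModel_surjective (p : M) (v : EndF F) : ∃ V, toModel (F := F) p V = v := by
  refine ⟨(triv F p).symmL ℝ p ∘L v ∘L (triv F p).continuousLinearMapAt ℝ p, ?_⟩
  refine ContinuousLinearMap.ext fun a => ?_
  rw [toModel_apply]
  simp only [ContinuousLinearMap.comp_apply]
  rw [triv_right (mem_triv p), triv_right (mem_triv p)]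

namespace GeneralizedMetric
variable {n : ℕ} (𝔤 : GeneralizedMetric F M n) 

/-- The vertical space `𝒱_K`, the tangent space at `K` of the fibre of `𝒢`. -/
def vertical (K : EndTot F M) : Submodule ℝ (EndT F K.1) where
  carrier := {V | (∀ a, V (K.2 a) + K.2 (V a) = 0) ∧ (∀ a b, pair K.1 (V a) b + pair K.1 a (V b) = 0) ∧
    ∀ a ∈ 𝔤.E K.1, V a ∈ 𝔤.E K.1}
  zero_mem' := by
    refine ⟨fun a => ?_, fun a b => ?_, fun a _ => ?_⟩ <;>
      simp only [_root_.zero_apply, map_zero, add_zero, LinearMap.zero_apply, Submodule.zero_mem]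
  add_mem' := by
    rintro V W ⟨h1, h2, h3⟩ ⟨k1, k2, k3⟩
    refine ⟨fun a => ?_, fun a b => ?_, fun a ha => ?_⟩
    · simp only [_root_.add_apply, map_add]
      rw [add_add_add_comm, h1, k1, add_zero]
    · simp only [_root_.add_apply, map_add, LinearMap.add_apply]
      rw [add_add_add_comm, h2, k2, add_zero]
    · exact Submodule.add_mem _ (h3 a ha) (k3 a ha)
  smul_mem' := by
    rintro c V ⟨h1, h2, h3⟩
    refine ⟨fun a => ?_, fun a b => ?_, fun a ha => ?_⟩
    · simp only [_root_.smul_apply, map_smul]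
      rw [← smul_add, h1, smul_zero]
    · simp only [_root_.smul_apply, map_smul, LinearMap.smul_apply]
      rw [← smul_add, h2, smul_zero]
    · exact Submodule.smul_mem _ c (h3 a ha)

theorem mem_vertical {K : EndTot F M} {V : EndT F K.1} : V ∈ 𝔤.vertical K ↔
    IsModelTan (pairing F) (graph (formAt 𝔤 K.1 K.1)) (toModel K.1 K.2) (toModel K.1 V) := by
  have hx := mem_triv (F := F) K.1
  constructor
  · rintro ⟨h1, h2, h3⟩
    refine ⟨fun a => ?_, fun a b => ?_, fun a ha => ?_⟩
    · simp only [toModel_apply]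
      rw [triv_left hx, triv_left hx, ← map_add, h1, map_zero]
    · have := h2 ((triv F K.1).symmL ℝ K.1 a) ((triv F K.1).symmL ℝ K.1 b)
      rwa [← pair_triv hx, ← pair_triv hx, triv_right hx, triv_right hx] at this
    · have : (triv F K.1).symmL ℝ K.1 a ∈ 𝔤.E K.1 := by
        rw [← mem_E_triv 𝔤 hx, triv_right hx]; exact ha
      exact (mem_E_triv 𝔤 hx _).2 (h3 _ this)
  · intro h
    refine ⟨fun a => ?_, fun a b => ?_, fun a ha => ?_⟩
    · have := congrArg ((triv F K.1).symmL ℝ K.1) (h.anti ((triv F K.1).continuousLinearMapAt ℝ K.1 a))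
      simp only [toModel_apply] at this
      rwa [triv_left hx, triv_left hx, map_add, triv_left hx, triv_left hx, triv_left hx, map_zero] at this
    · have := h.skew ((triv F K.1).continuousLinearMapAt ℝ K.1 a) ((triv F K.1).continuousLinearMapAt ℝ K.1 b)
      simp only [toModel_apply] at this
      rwa [triv_left hx, triv_left hx, pair_triv hx, pair_triv hx] at this
    · have := h.pres _ ((mem_E_triv 𝔤 hx _).2 ha)
      rw [toModel_apply, triv_left hx] at this
      rwa [mem_E_triv 𝔤 hx] at this

/-- The vertical tangent vector of the total space that corresponds to `V`. The tangent space of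
the total space at `K` is `F × End(F ⊕ F*)` by means of the trivialization centered at the base
point of `K`. -/
def verticalLift (K : EndTot F M) : 𝔤.vertical K →ₗ[ℝ] TangentSpace (IE F) K where
  toFun V := ((0, toModel K.1 V) : F × EndF F)
  map_add' V W := Prod.ext (add_zero (0 : F)).symm (map_add (toModel K.1) (V : EndT F K.1) W)
  map_smul' c V := Prod.ext (smul_zero (A := F) c).symm (map_smul (toModel K.1) c (V : EndT F K.1))
end GeneralizedMetric

variable [FiniteDimensional ℝ F] (D : CovariantDerivative 𝓘(ℝ, F) (GF F) (fun x : M => GT F x))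

/-- The lift of `X` to the horizontal space `ℋ_K` of the connection induced by `D` on the
endomorphism bundle, `(D_X σ)(s) = D_X (σ s) - σ (D_X s)`. In the trivialization centered at the
base point, the induced connection is `D_X σ = dσ(X) + [Γ(X), σ]`, so the horizontal vectors at `K`
are `(X, -[Γ(X), K])`. -/
def horizontalLift (K : EndTot F M) : TangentSpace 𝓘(ℝ, F) K.1 →ₗ[ℝ] TangentSpace (IE F) K where
  toFun X := ((X, toModel K.1 K.2 ∘L christoffel D K.1 X - christoffel D K.1 X ∘L toModel K.1 K.2) : F × EndF F)
  map_add' X Y := by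
    refine Prod.ext rfl (Eq.trans ?_ (add_sub_add_comm (toModel K.1 K.2 ∘L christoffel D K.1 X) _ _ _))
    rw [christoffel_add, ContinuousLinearMap.comp_add, ContinuousLinearMap.add_comp]
  map_smul' c X := by
    refine Prod.ext rfl (Eq.trans ?_ (smul_sub c (toModel K.1 K.2 ∘L christoffel D K.1 X) _).symm)
    rw [christoffel_smul, ContinuousLinearMap.comp_smul, ContinuousLinearMap.smul_comp]
end Splitting

section Splitting2
open Bundle Manifold
variable {F : Type*} [NormedAddCommGroup F] [NormedSpace ℝ F] [FiniteDimensional ℝ F]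
variable {M : Type*} [TopologicalSpace M] [ChartedSpace F M] [IsManifold 𝓘(ℝ, F) ∞ M]
namespace GeneralizedMetric
variable {n : ℕ} (𝔤 : GeneralizedMetric F M n) (D : CovariantDerivative 𝓘(ℝ, F) (GF F) (fun x : M => GT F x))

theorem sum_injective (K : EndTot F M) {X : TangentSpace 𝓘(ℝ, F) K.1} {V : 𝔤.vertical K}
    (h : horizontalLift D K X + 𝔤.verticalLift K V = 0) : X = 0 ∧ V = 0 := by
  have h1 : (show F from X) + (0 : F) = 0 := congrArg Prod.fst (show (_ : F × EndF F) = 0 from h)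
  have hX : X = 0 := (add_zero (show F from X)).symm.trans h1
  subst hX
  refine ⟨rfl, ?_⟩
  rw [map_zero, zero_add] at h
  have h2 : toModel K.1 (V : EndT F K.1) = 0 := congrArg Prod.snd (show (_ : F × EndF F) = 0 from h)
  exact Subtype.ext (toModel_injective K.1 (h2.trans (LinearMap.map_zero (toModel K.1)).symm))

theorem hasDerivAt_formAt {p : M} {x : ℝ → M} (hx : ContMDiffAt 𝓘(ℝ, ℝ) 𝓘(ℝ, F) ∞ x 0) (hx0 : x 0 = p) 
    {X : TangentSpace 𝓘(ℝ, F) p} (hX : (mfderiv 𝓘(ℝ, ℝ) 𝓘(ℝ, F) x 0 (1 : ℝ) : F) = X) :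
    ContDiffAt ℝ ∞ (fun t => formAt 𝔤 p (x t)) 0 ∧
    HasDerivAt (fun t => formAt 𝔤 p (x t)) (mvfderiv 𝓘(ℝ, F) (formAt 𝔤 p) p X) 0 := by
  subst hx0
  have h1 := (contMDiffAt_formAt 𝔤 (x 0)).comp (0 : ℝ) hx
  refine ⟨h1.contDiffAt, ?_⟩
  have h2 := ((contMDiffAt_formAt 𝔤 (x 0)).mdifferentiableAt (by simp)).hasMFDerivAt.comp (0 : ℝ) (hx.mdifferentiableAt (by simp)).hasMFDerivAt
  have h3 := hasFDerivAt_of_hasMFDerivAt h2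
  have h4 := h3.hasDerivAt
  subst hX
  exact h4

theorem velocity_mem {n : ℕ} (hn : 1 ≤ n) {𝔤 : GeneralizedMetric F M n} 
    {D : CovariantDerivative 𝓘(ℝ, F) (GF F) (fun x : M => GT F x)} 
    (hD : 𝔤.IsDirectSumConnection D) {γ : ℝ → EndTot F M}
    (hγ : ContMDiffAt 𝓘(ℝ, ℝ) (IE F) ∞ γ 0) (hγ2 : ∀ᶠ t in 𝓝 0, γ t ∈ 𝔤.reflector) 
    {X : TangentSpace 𝓘(ℝ, F) (γ 0).1} (hX : (mfderiv 𝓘(ℝ, ℝ) 𝓘(ℝ, F) (fun t => (γ t).proj) 0 (1 : ℝ) : F) = X) :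
    ∃ V : 𝔤.vertical (γ 0), 
      mfderiv 𝓘(ℝ, ℝ) (IE F) γ 0 (1 : ℝ) = horizontalLift D (γ 0) X + 𝔤.verticalLift (γ 0) V := by
  obtain ⟨h1, h2, h3⟩ := velocity hγ
  have hq := (hasDerivAt_formAt 𝔤 h1 rfl hX).2
  have hbase : ∀ᶠ t in 𝓝 (0 : ℝ), (γ t).proj ∈ (triv F (γ 0).proj).baseSet :=
    h1.continuousAt.eventually ((triv F (γ 0).proj).open_baseSet.mem_nhds (mem_triv _))
  have hf := (h2.differentiableAt (by simp)).hasDerivAt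
  have hm : ∀ᶠ t in 𝓝 (0 : ℝ), IsModelPt (pairing F) (graph (formAt 𝔤 (γ 0).proj (γ t).proj))
      (etriv F (γ 0).proj (γ t)).2 := by
    filter_upwards [hγ2, hbase] with t ht1 ht2
    exact (reflector_triv 𝔤 hn ht2).1 ht1
  have hT := isModelTan_of_curve hq hf hm (christoffel_skew hD (γ 0).proj X) (christoffel_graph hD (γ 0).proj X)
  obtain ⟨V, hV⟩ := toModel_surjective (γ 0).proj (deriv (fun t => (etriv F (γ 0).proj (γ t)).2) 0 +
    (christoffel D (γ 0).proj X ∘L (etriv F (γ 0).proj (γ 0)).2 - (etriv F (γ 0).proj (γ 0)).2 ∘L christoffel D (γ 0).proj X))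
  rw [← hV] at hT
  refine ⟨⟨V, 𝔤.mem_vertical.2 hT⟩, h3.trans (Prod.ext (hX.trans (add_zero (show F from X)).symm) ?_)⟩
  show _ = (toModel (γ 0).1 (γ 0).2 ∘L christoffel D (γ 0).1 X - christoffel D (γ 0).1 X ∘L toModel (γ 0).1 (γ 0).2) + toModel (γ 0).1 V
  rw [hV]
  show _ = ((etriv F (γ 0).proj (γ 0)).2 ∘L christoffel D (γ 0).1 X - christoffel D (γ 0).1 X ∘L (etriv F (γ 0).proj (γ 0)).2) + _
  abel

theorem eq_of_coord {p : M} {K K' : EndTot F M} (hK : K.proj = p) (hK' : K'.proj = p)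
    (h : (etriv F p K).2 = (etriv F p K').2) : K = K' := by
  have hs : ∀ {L : EndTot F M}, L.proj = p → L ∈ (etriv F p).source := fun {L} hL => by
    rw [Trivialization.mem_source, hL]; exact FiberBundle.mem_baseSet_trivializationAt' p
  refine (etriv F p).injOn (hs hK) (hs hK') (Prod.ext ?_ h)
  show (etriv F p K).1 = (etriv F p K').1
  rw [(etriv F p).coe_fst (hs hK), (etriv F p).coe_fst (hs hK'), hK, hK']

theorem verticalLift_mem (hn : 1 ≤ n) {K : EndTot F M} (hK : K ∈ 𝔤.reflector) (V : 𝔤.vertical K) :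
    𝔤.verticalLift K V ∈ 𝔤.tangent K := by
  have hm := (reflector_triv 𝔤 hn (mem_triv K.1)).1 hK
  have hT := 𝔤.mem_vertical.1 V.2
  obtain ⟨c, hc, hc0, hcd, hev⟩ := exists_vertical_curve hm hT.anti hT.skew hT.pres
  obtain ⟨γ, h1, h2, h3⟩ := exists_curve (p := K.1) (x := fun _ => K.1) (c := c) contMDiffAt_const rfl hc
  have h0 : γ 0 = K := by
    refine eq_of_coord (p := K.1) (by simp [h2]) rfl ?_
    rw [h3.self_of_nhds.2, hc0]
  refine Submodule.subset_span ⟨γ, h1, h0, ?_, ?_⟩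
  · filter_upwards [hev, h3] with t ht1 ht2
    rw [reflector_triv 𝔤 hn ht2.1, ht2.2, h2]
    exact ht1
  · obtain ⟨k1, k2, k3⟩ := velocity h1
    have e : deriv (fun t => (etriv F (γ 0).proj (γ t)).2) 0 = toModel K.1 V := by
      rw [h2]; exact (hcd.congr_of_eventuallyEq (h3.mono fun t ht => ht.2)).deriv
    have e2 : (mfderiv 𝓘(ℝ, ℝ) 𝓘(ℝ, F) (fun t => (γ t).proj) 0 (1 : ℝ) : F) = 0 := by
      have : (fun t => (γ t).proj) = fun _ => K.1 := funext h2
      have h5 : HasMFDerivAt 𝓘(ℝ, ℝ) 𝓘(ℝ, F) (fun t => (γ t).proj) 0 (0 : ℝ →L[ℝ] F) := by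
        rw [this]; exact hasMFDerivAt_const _ _
      exact congrArg (fun L : ℝ →L[ℝ] F => L 1) h5.mfderiv
    exact k3.trans (Prod.ext e2 e)

theorem horizontalLift_mem (hn : 1 ≤ n) {𝔤 : GeneralizedMetric F M n} 
    {D : CovariantDerivative 𝓘(ℝ, F) (GF F) (fun x : M => GT F x)} 
    (hD : 𝔤.IsDirectSumConnection D) {K : EndTot F M} (hK : K ∈ 𝔤.reflector) (X : TangentSpace 𝓘(ℝ, F) K.1) :
    horizontalLift D K X ∈ 𝔤.tangent K := by
  have hm := (reflector_triv 𝔤 hn (mem_triv K.1)).1 hK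
  obtain ⟨x, hx, hx0, hX⟩ := exists_base_curve K.1 X
  obtain ⟨hq, -⟩ := hasDerivAt_formAt 𝔤 hx hx0 hX
  have hm' : IsModelPt (pairing F) (graph (formAt 𝔤 K.1 (x 0))) (etriv F K.1 K).2 := by
    rw [hx0]; exact hm
  obtain ⟨c, hc, hc0, hev⟩ := exists_horizontal_curve hq 
    (fun u hu => formAt_nondeg 𝔤 (x := x 0) (by rw [hx0]; exact mem_triv _) u hu) hm'
  obtain ⟨γ, h1, h2, h3⟩ := exists_curve hx hx0 hc
  obtain rfl : x = fun t => (γ t).proj := funext fun t => (h2 t).symm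
  have h0 : γ 0 = K := by
    refine eq_of_coord (p := K.1) hx0 rfl ?_
    rw [h3.self_of_nhds.2, hc0]
  have hr : ∀ᶠ t in 𝓝 0, γ t ∈ 𝔤.reflector := by
    filter_upwards [hev, h3] with t ht1 ht2
    rw [reflector_triv 𝔤 hn ht2.1, ht2.2]
    exact ht1
  have hw := Submodule.subset_span (R := ℝ) (s := {w | ∃ γ : ℝ → EndTot F M, ContMDiffAt 𝓘(ℝ, ℝ) (IE F) ∞ γ 0 ∧ γ 0 = K ∧
    (∀ᶠ t in 𝓝 0, γ t ∈ 𝔤.reflector) ∧ (mfderiv 𝓘(ℝ, ℝ) (IE F) γ 0 (1 : ℝ) : F × EndF F) = w}) ⟨γ, h1, h0, hr, rfl⟩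
  subst h0
  obtain ⟨V, hV⟩ := velocity_mem hn hD h1 hr hX
  have : horizontalLift D (γ 0) X = mfderiv 𝓘(ℝ, ℝ) (IE F) γ 0 (1 : ℝ) - 𝔤.verticalLift (γ 0) V := by
    rw [hV, add_sub_cancel_right]
  rw [this]
  exact Submodule.sub_mem _ hw (verticalLift_mem 𝔤 hn hK V)
end GeneralizedMetric
end Splitting2

section Splitting3
open Bundle Manifold
variable {F : Type*} [NormedAddCommGroup F] [NormedSpace ℝ F] [FiniteDimensional ℝ F]
variable {M : Type*} [TopologicalSpace M] [ChartedSpace F M] [IsManifold 𝓘(ℝ, F) ∞ M]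
namespace GeneralizedMetric
variable {n : ℕ} (𝔤 : GeneralizedMetric F M n) {D : CovariantDerivative 𝓘(ℝ, F) (GF F) (fun x : M => GT F x)}

theorem isCompl (x : M) : IsCompl (𝔤.E x) (𝔤.Eperp x) := by
  have hsymm : (pair x : LinearMap.BilinForm ℝ (GT F x)).IsRefl := by
    intro a b h
    rw [pairing_apply] at h ⊢
    linarith
  refine (LinearMap.BilinForm.isCompl_orthogonal_iff_disjoint hsymm).2 ?_
  rw [Submodule.disjoint_def]
  rintro ⟨u, α⟩ h1 h2
  have h3 := mem_graph.1 h1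
  simp only at h3
  subst h3
  have hu : u = 0 := by
    refine g_nondeg 𝔤 x u fun v => ?_
    have h4 : pair x (v, (𝔤.g x + 𝔤.Θ x) v) (u, (𝔤.g x + 𝔤.Θ x) u) = 0 := h2 _ (mem_graph.2 rfl)
    rw [pairing_apply] at h4
    simp only [_root_.add_apply] at h4
    rw [𝔤.symm x v u, Θ_swap 𝔤 x v u] at h4
    linarith
  subst hu
  simp

/-- The endomorphism equal to `s` on `E'` and to `t` on `E''`. -/
def signs (s t : ℝ) (x : M) : EndT F x :=
  LinearMap.toContinuousLinearMap (s • (𝔤.E x).projection (𝔤.Eperp x) (𝔤.isCompl x) +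
    t • (𝔤.Eperp x).projection (𝔤.E x) (𝔤.isCompl x).symm)

theorem signs_apply (s t : ℝ) {x : M} {a b : GT F x} (ha : a ∈ 𝔤.E x) (hb : b ∈ 𝔤.Eperp x) :
    𝔤.signs s t x (a + b) = s • a + t • b := by
  show s • (𝔤.E x).projection (𝔤.Eperp x) (𝔤.isCompl x) (a + b) +
    t • (𝔤.Eperp x).projection (𝔤.E x) (𝔤.isCompl x).symm (a + b) = _
  rw [map_add, map_add, Submodule.projection_apply_of_mem_left _ ha,
    Submodule.projection_apply_of_mem_right _ hb, Submodule.projection_apply_of_mem_left _ hb,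
    Submodule.projection_apply_of_mem_right _ ha, add_zero, zero_add]

theorem exists_add (x : M) (a : GT F x) : ∃ u ∈ 𝔤.E x, ∃ v ∈ 𝔤.Eperp x, u + v = a :=
  Submodule.mem_sup.1 ((𝔤.isCompl x).sup_eq_top ▸ Submodule.mem_top)

theorem pair_comm (x : M) (a b : GT F x) : pair x a b = pair x b a := by
  rw [pairing_apply, pairing_apply, add_comm]

theorem mem_perp_of_skew {x : M} {V : EndT F x} (hV : ∀ a b, pair x (V a) b + pair x a (V b) = 0)
    (hE : ∀ a ∈ 𝔤.E x, V a ∈ 𝔤.E x) {a : GT F x} (ha : a ∈ 𝔤.Eperp x) : V a ∈ 𝔤.Eperp x := by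
  intro e he
  have h1 := hV e a
  have h2 : pair x (V e) a = 0 := ha _ (hE e he)
  rw [h2, zero_add] at h1
  exact h1

theorem signs_comm (s t : ℝ) {x : M} {V : EndT F x}
    (hV : ∀ a b, pair x (V a) b + pair x a (V b) = 0) (hE : ∀ a ∈ 𝔤.E x, V a ∈ 𝔤.E x)
    (a : GT F x) : 𝔤.signs s t x (V a) = V (𝔤.signs s t x a) := by
  obtain ⟨u, hu, v, hv, rfl⟩ := 𝔤.exists_add x a
  rw [signs_apply 𝔤 s t hu hv, map_add V, signs_apply 𝔤 s t (hE u hu) (𝔤.mem_perp_of_skew hV hE hv),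
    map_add, map_smul, map_smul]

theorem signs_adj (s t : ℝ) {x : M} (a b : GT F x) :
    pair x (𝔤.signs s t x a) b = pair x a (𝔤.signs s t x b) := by
  obtain ⟨u, hu, v, hv, rfl⟩ := 𝔤.exists_add x a
  obtain ⟨u', hu', v', hv', rfl⟩ := 𝔤.exists_add x b
  rw [signs_apply 𝔤 s t hu hv, signs_apply 𝔤 s t hu' hv']
  have h1 : pair x u v' = 0 := hv' u hu
  have h2 : pair x v u' = 0 := by rw [pair_comm]; exact hv u' hu'
  simp only [map_add, map_smul, LinearMap.add_apply, LinearMap.smul_apply, h1, h2]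
  simp

/-- The paracomplex structures `P_ε`, `ε = 1, 2, 3, 4`, on the vertical spaces (indexed by
`0, 1, 2, 3`): if `V = (V', V'')` and `K = (K', K'')` under the decomposition `E' ⊕ E''`, these are
`(K' V', K'' V'')`, `(K' V', -K'' V'')`, `(-K' V', K'' V'')` and `(-K' V', -K'' V'')`. -/
def verticalStr (ε : Fin 4) {K : EndTot F M} (hK : K ∈ 𝔤.reflector) :
    𝔤.vertical K →ₗ[ℝ] 𝔤.vertical K where
  toFun V := ⟨K.2 ∘L (V : EndT F K.1) ∘L 𝔤.signs (![1, 1, -1, -1] ε) (![1, -1, 1, -1] ε) K.1, by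
    obtain ⟨V, hV1, hV2, hV3⟩ := V
    obtain ⟨hK1, hK2⟩ := hK
    have c1 := signs_comm 𝔤 (![1, 1, -1, -1] ε) (![1, -1, 1, -1] ε) hV2 hV3
    have c2 := signs_comm 𝔤 (![1, 1, -1, -1] ε) (![1, -1, 1, -1] ε) hK1.skew hK2
    refine ⟨fun a => ?_, fun a b => ?_, fun a ha => ?_⟩
    · simp only [ContinuousLinearMap.comp_apply]
      rw [c2, ← ContinuousLinearMap.map_add, hV1, ContinuousLinearMap.map_zero]
    · simp only [ContinuousLinearMap.comp_apply]
      rw [← c1 b, ← c2, ← signs_adj]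
      have h1 := hK1.skew (V (𝔤.signs (![1, 1, -1, -1] ε) (![1, -1, 1, -1] ε) K.1 a)) b
      have h2 := hV2 (𝔤.signs (![1, 1, -1, -1] ε) (![1, -1, 1, -1] ε) K.1 a) (K.2 b)
      have h3 := congrArg (pair K.1 (𝔤.signs (![1, 1, -1, -1] ε) (![1, -1, 1, -1] ε) K.1 a)) (hV1 b)
      rw [map_add, map_zero] at h3
      linarith
    · have := signs_apply 𝔤 (![1, 1, -1, -1] ε) (![1, -1, 1, -1] ε) ha (Submodule.zero_mem (𝔤.Eperp K.1))
      rw [add_zero, smul_zero, add_zero] at this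
      simp only [ContinuousLinearMap.comp_apply]
      rw [this, ContinuousLinearMap.map_smul, ContinuousLinearMap.map_smul]
      exact Submodule.smul_mem _ _ (hK2 _ (hV3 a ha))⟩
  map_add' V W := by
    apply Subtype.ext
    refine ContinuousLinearMap.ext fun a => ?_
    exact map_add K.2 _ _
  map_smul' c V := by
    apply Subtype.ext
    refine ContinuousLinearMap.ext fun a => ?_
    exact map_smul K.2 c _

/-- The splitting `T_K𝒢 = ℋ_K ⊕ 𝒱_K`, with `ℋ_K ≅ T_pM`. -/
def splitting (hn : 1 ≤ n) (hD : 𝔤.IsDirectSumConnection D) {K : EndTot F M}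
    (hK : K ∈ 𝔤.reflector) : (TangentSpace 𝓘(ℝ, F) K.1 × 𝔤.vertical K) ≃ₗ[ℝ] 𝔤.tangent K :=
  (LinearEquiv.ofInjective ((horizontalLift D K).coprod (𝔤.verticalLift K)) (LinearMap.ker_eq_bot.1 (LinearMap.ker_eq_bot'.2 fun a h =>
      Prod.ext (𝔤.sum_injective D K h).1 (𝔤.sum_injective D K h).2))).trans (LinearEquiv.ofEq _ _ (by
    apply le_antisymm
    · rintro _ ⟨⟨X, V⟩, rfl⟩
      exact Submodule.add_mem _ (horizontalLift_mem hn hD hK X) (𝔤.verticalLift_mem hn hK V)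
    · refine Submodule.span_le.2 ?_
      rintro w ⟨γ, h1, rfl, h3, rfl⟩
      obtain ⟨V, hV⟩ := velocity_mem hn hD h1 h3 rfl
      exact ⟨(_, V), hV.symm⟩))

theorem splitting_apply (hn : 1 ≤ n) (hD : 𝔤.IsDirectSumConnection D) {K : EndTot F M}
    (hK : K ∈ 𝔤.reflector) (a : TangentSpace 𝓘(ℝ, F) K.1 × 𝔤.vertical K) :
    (𝔤.splitting hn hD hK a : TangentSpace (IE F) K) =
      horizontalLift D K a.1 + 𝔤.verticalLift K a.2 := rfl

/-- The structures `𝒦_ε` on `T_K𝒢 ⊕ T_K*𝒢 = (ℋ ⊕ ℋ*) ⊕ (𝒱 ⊕ 𝒱*)`: the lift of the endomorphism `K`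
of `TM ⊕ T*M` on `ℋ ⊕ ℋ*`, and `P_ε` on `𝒱`, `-P_ε*` on `𝒱*`. -/
def reflectorStr (hn : 1 ≤ n) (hD : 𝔤.IsDirectSumConnection D) (ε : Fin 4) (K : 𝔤.reflector) :
    Module.End ℝ (Gen (𝔤.tangent K)) :=
  liftStr (𝔤.splitting hn hD K.2) K.1.2 (𝔤.verticalStr ε K.2)

instance (K : EndTot F M) : FiniteDimensional ℝ (TangentSpace (IE F) K) :=
  inferInstanceAs (FiniteDimensional ℝ (F × EndF F))

/-- `𝒥` is a `B`-transform of `𝒥₀`, that is, `𝒥 = e^B 𝒥₀ e^{-B}` for a `2`-form `B` on `𝒢`. -/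
def IsBTransform (𝒥 𝒥₀ : ∀ K : 𝔤.reflector, Module.End ℝ (Gen (𝔤.tangent K))) : Prop :=
  ∃ B : ∀ K : 𝔤.reflector, LinearMap.BilinForm ℝ (𝔤.tangent K), (∀ K, (B K).IsAlt) ∧
    ∀ K, 𝒥 K = expB (B K) * 𝒥₀ K * expB (-B K)

end GeneralizedMetric
end Splitting3

end GenReflector

end

open scoped Manifold ContDiff

namespace GenReflector

/-! ### The effect of B-transforms on the component from covectors to vectors -/

section Linear

variable {T : Type*} [AddCommGroup T] [Module ℝ T]

/-! For an endomorphism `J` of `T ⊕ T*` consider its component `β_J : T* → T`, `ξ ↦ (J (0, ξ)).1`.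
Both `e^B` and `e^{-B}` fix `T*` pointwise and leave vector components unchanged, so `β_J` is
invariant under B-transforms (`expB_conj_dual_fst`). The theorem follows by comparing this invariant
at two well-chosen points of the reflector space; everything is pointwise, which is why the fields
may be arbitrary.

For the trivial structure and for `K_P` the invariant vanishes at every point; for `K_ω` it is
`ω⁻¹`, hence injective; for `K_π` it is `ξ ↦ -ι_ξ π`. For the structures `𝒦_ε` at a point `K` it is
the horizontal lift of the invariant of `K` itself: `P_ε` and `-P_ε*` act separately on vertical
vectors and vertical covectors and contribute nothing. Hence the four values of `ε` need no
distinction.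

Two points over the same base point therefore suffice. If `β_K ≠ 0`, then `𝒦_ε` is a transform
neither of the trivial structure nor of any `K_P`. If `β_K = 0` and `T* ≠ 0`, an injective invariant
is impossible, which excludes `K_ω`; and `K_π` would need `π = 0` at `K`, so that its component from
vectors to vectors would be the identity, which also survives the B-transform, whereas `K` can be
chosen to act differently on `T`.

The two points come from a `g`-skew product structure `L` on the tangent space, which exists because
the signature is `(n, n)` (`exists_skew_product`). Conjugating `L ⊕ (-L*)` by `e^Θ` gives a point
`(K', K'')` that preserves `T*` (`exists_reflector_diagonal`). Changing the sign of `K''` gives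
`(K', -K'')`, whose invariant sends `g(u)` to `L u`, so it is non-zero
(`exists_reflector_offDiagonal`). -/

theorem expB_conj_fst (B : LinearMap.BilinForm ℝ T) (J : Module.End ℝ (Gen T)) (a : Gen T) :
    ((expB B * J * expB (-B)) a).1 = (J (a.1, a.2 - B a.1)).1 := by
  simp [expB, sub_eq_add_neg]

/-- The shift by `B` is by the contraction with the vector component, which is zero on a covector.
This is the invariance on which every non-equivalence below rests. -/
theorem expB_conj_dual_fst (B : LinearMap.BilinForm ℝ T) (J : Module.End ℝ (Gen T))
    (ξ : Module.Dual ℝ T) : ((expB B * J * expB (-B)) (0, ξ)).1 = (J (0, ξ)).1 := by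
  rw [expB_conj_fst]; simp

/-! ### Comparison of a lifted structure with the four model structures -/

section Lift

variable {W V : Type*} [AddCommGroup W] [Module ℝ W] [AddCommGroup V] [Module ℝ V]
  [TopologicalSpace T] [IsTopologicalAddGroup T] [ContinuousSMul ℝ T] [T2Space T]
  [FiniteDimensional ℝ T] (Φ : (T × V) ≃ₗ[ℝ] W)
  (J : (T × (T →L[ℝ] ℝ)) →L[ℝ] (T × (T →L[ℝ] ℝ))) (P : V →ₗ[ℝ] V)

/-- The extension by zero on `V` of a linear form on `T`. -/
noncomputable def extendDual (α : T →L[ℝ] ℝ) : Module.Dual ℝ W :=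
  (α : T →ₗ[ℝ] ℝ) ∘ₗ LinearMap.fst ℝ T V ∘ₗ Φ.symm.toLinearMap

omit [IsTopologicalAddGroup T] [ContinuousSMul ℝ T] [T2Space T] [FiniteDimensional ℝ T] in
theorem extendDual_apply (α : T →L[ℝ] ℝ) (X : T) (v : V) :
    extendDual Φ α (Φ (X, v)) = α X := by
  simp [extendDual]

/-- On covectors the vertical block acts by `-P*`, which has values in covectors; only `J` can
produce a vector, and that vector is horizontal. -/
theorem liftStr_extendDual_fst (α : T →L[ℝ] ℝ) :
    (liftStr Φ J P (0, extendDual Φ α)).1 = Φ ((J (0, α)).1, 0) := by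
  -- The lift reads off the horizontal part of a covector by restricting it to `T`, and restriction
  -- undoes the extension by zero.
  have h : LinearMap.toContinuousLinearMap
      (extendDual Φ α ∘ₗ Φ.toLinearMap ∘ₗ LinearMap.inl ℝ T V) = α := by
    ext X; simp [extendDual]
  simp [liftStr, h]

theorem liftStr_horizontal_fst (X : T) :
    (liftStr Φ J P (Φ (X, 0), 0)).1 = Φ ((J (X, 0)).1, 0) := by
  simp [liftStr]

/-- The vertical block always preserves `V*`, so the lift preserves all of `W*` as soon as `J`
preserves `T*`. -/
theorem liftStr_dual_fst (hJ : ∀ α, (J (0, α)).1 = 0) (ξ : Module.Dual ℝ W) :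
    (liftStr Φ J P (0, ξ)).1 = 0 := by
  simp [liftStr, hJ]

variable {Φ J P} {B : LinearMap.BilinForm ℝ W}

/-- The invariant of `J₀` vanishes, hence so does that of the lift; testing the latter on covectors
extended from `T` recovers the invariant of `J`. This serves both the trivial structure and `K_P`.
-/
theorem fst_eq_zero_of_liftStr_eq {J₀ : Module.End ℝ (Gen W)} (hJ₀ : ∀ ξ, (J₀ (0, ξ)).1 = 0)
    (h : liftStr Φ J P = expB B * J₀ * expB (-B)) (α : T →L[ℝ] ℝ) : (J (0, α)).1 = 0 := by
  have h1 := liftStr_extendDual_fst Φ J P α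
  rw [h, expB_conj_dual_fst, hJ₀] at h1
  exact (Prod.mk_eq_zero.1 ((LinearEquiv.map_eq_zero_iff Φ).1 h1.symm)).1

/-- The invariant of `K_ω` is the isomorphism `ω⁻¹`, while that of the lift is zero; the two can
agree only if `T*` is trivial. A non-zero `α` will contradict this. -/
theorem dual_eq_zero_of_liftStr_eq_symplecticStr [FiniteDimensional ℝ W]
    {w : LinearMap.BilinForm ℝ W} {hw : w.Nondegenerate} (hJ : ∀ α, (J (0, α)).1 = 0)
    (h : liftStr Φ J P = expB B * symplecticStr w hw * expB (-B)) (α : T →L[ℝ] ℝ) : α = 0 := by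
  have h1 := liftStr_dual_fst Φ J P hJ (extendDual Φ α)
  rw [h, expB_conj_dual_fst] at h1
  -- The vector component of `K_ω (0, ξ)` is by definition `ω⁻¹(ξ)`.
  have h2 : extendDual Φ α = 0 := (LinearEquiv.map_eq_zero_iff (w.toDual hw).symm).1 h1
  ext X
  rw [← extendDual_apply Φ α X 0, h2]
  rfl

/-- Vanishing of the invariant forces every contraction with the 2-vector to vanish. Then `K_π`
keeps the vector component of its argument, whatever covector `B` adds to it, so `J` must do the
same on `T`. -/
theorem fst_eq_of_liftStr_eq_bivectorStr {b : ⋀[ℝ]^2 W} (hJ : ∀ α, (J (0, α)).1 = 0)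
    (h : liftStr Φ J P = expB B * bivectorStr b * expB (-B)) (u : T) : (J (u, 0)).1 = u := by
  have hb : ∀ ξ, contract ξ b = 0 := by
    intro ξ
    have h1 := liftStr_dual_fst Φ J P hJ ξ
    rw [h, expB_conj_dual_fst] at h1
    simpa [bivectorStr] using h1
  have h1 := liftStr_horizontal_fst Φ J P u
  rw [h, expB_conj_fst] at h1
  -- The covector `-B(X)` introduced by `e^{-B}` enters the vector component only through a
  -- contraction, which `hb` annihilates.
  simp only [bivectorStr, LinearMap.coe_mk, AddHom.coe_mk, hb, sub_zero] at h1
  exact (congrArg Prod.fst (Φ.injective h1)).symm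

end Lift

end Linear

/-! ### Skew product structures on a pseudo-Euclidean space of neutral signature -/

section Fibre

open Bundle Manifold ContDiff

variable {F : Type*} [NormedAddCommGroup F] [NormedSpace ℝ F] [FiniteDimensional ℝ F]
variable {M : Type*} [TopologicalSpace M] [ChartedSpace F M] [IsManifold 𝓘(ℝ, F) ∞ M]

namespace GeneralizedMetric

variable {n : ℕ} (𝔤 : GeneralizedMetric F M n)

/-- On each tangent space there is a product structure that is skew-symmetric for the metric; it
exchanges the positive and the negative vectors of an orthonormal basis. -/
theorem exists_skew_product (hn : 1 ≤ n) (x : M) :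
    ∃ L : TangentSpace 𝓘(ℝ, F) x →L[ℝ] TangentSpace 𝓘(ℝ, F) x,
      (∀ u, L (L u) = u) ∧ (∀ u v, 𝔤.g x (L u) v + 𝔤.g x u (L v) = 0) ∧
      ∃ u, L u ≠ u ∧ L u ≠ 0 ∧ 𝔤.g x u ≠ 0 := by
  obtain ⟨b, h0, h1, h2⟩ := 𝔤.signature x
  let L₀ : TangentSpace 𝓘(ℝ, F) x →ₗ[ℝ] TangentSpace 𝓘(ℝ, F) x :=
    b.constr ℝ (fun i => b i.swap)
  have hb : ∀ i, L₀ (b i) = b i.swap := fun i => b.constr_basis ℝ _ i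
  let L : TangentSpace 𝓘(ℝ, F) x →L[ℝ] TangentSpace 𝓘(ℝ, F) x := LinearMap.toContinuousLinearMap L₀
  have hL : ∀ u, L u = L₀ u := fun _ => rfl
  refine ⟨L, fun u => ?_, fun u v => ?_, b (Sum.inl ⟨0, hn⟩), ?_, ?_, fun h => ?_⟩
  · have : L₀ ∘ₗ L₀ = LinearMap.id := b.ext fun i => by simp [hb]
    exact LinearMap.congr_fun this u
  · let G : LinearMap.BilinForm ℝ (TangentSpace 𝓘(ℝ, F) x) :=
      LinearMap.mk₂ ℝ (fun u v => 𝔤.g x u v) (by intros; simp) (by intros; simp)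
        (by intros; simp) (by intros; simp)
    have hG : ∀ u v, G u v = 𝔤.g x u v := fun _ _ => rfl
    -- Skewness is bilinear, so it is enough to test it on the orthonormal basis. For two basis
    -- vectors of the same sign both terms pair vectors of opposite sign and vanish. For opposite
    -- signs with the same index the terms are `1` and `-1`, and they cancel.
    have : G ∘ₗ L₀ + G.compl₂ L₀ = 0 := by
      refine LinearMap.BilinForm.ext_basis b fun i j => ?_
      simp only [LinearMap.add_apply, LinearMap.comp_apply, LinearMap.compl₂_apply, hb, hG,
        LinearMap.zero_apply]
      rcases i with i | i <;> rcases j with j | j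
      · rw [Sum.swap_inl, Sum.swap_inl, h0 _ _ (by simp), h0 _ _ (by simp), add_zero]
      · by_cases hij : i = j
        · subst hij; simp [h1, h2]
        · rw [Sum.swap_inl, Sum.swap_inr, h0 _ _ (by simpa), h0 _ _ (by simpa), add_zero]
      · by_cases hij : i = j
        · subst hij; simp [h1, h2]
        · rw [Sum.swap_inl, Sum.swap_inr, h0 _ _ (by simpa), h0 _ _ (by simpa), add_zero]
      · rw [Sum.swap_inr, Sum.swap_inr, h0 _ _ (by simp), h0 _ _ (by simp), add_zero]
    exact LinearMap.congr_fun₂ this u v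
  · rw [hL, hb]
    exact fun h => by simpa using b.injective h
  · rw [hL, hb]
    exact b.ne_zero _
  · have := h1 ⟨0, hn⟩
    rw [h] at this
    simp at this

/-! ### Points of the reflector space built from a skew product structure -/

variable {𝔤} {x : M} {L : TangentSpace 𝓘(ℝ, F) x →L[ℝ] TangentSpace 𝓘(ℝ, F) x}

variable (𝔤 L) in
/-- The endomorphism of `TM ⊕ T*M` which is the `Θ`-transform of `X + α ↦ L X - L* α`. -/
noncomputable def diagonalStr : EndT F x :=
  LinearMap.toContinuousLinearMap
    { toFun := fun a => (L a.1, 𝔤.Θ x (L a.1) - (a.2 - 𝔤.Θ x a.1) ∘L L)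
      map_add' := fun a b => by
        refine Prod.ext (by simp) (ContinuousLinearMap.ext fun v => ?_)
        simp
        ring
      map_smul' := fun c a => by
        refine Prod.ext (by simp) (ContinuousLinearMap.ext fun v => ?_)
        simp
        ring }

theorem diagonalStr_apply (a : GT F x) :
    𝔤.diagonalStr L a = (L a.1, 𝔤.Θ x (L a.1) - (a.2 - 𝔤.Θ x a.1) ∘L L) := rfl

theorem diagonalStr_sq (hL : ∀ u, L (L u) = u) (a : GT F x) :
    𝔤.diagonalStr L (𝔤.diagonalStr L a) = a := by
  rw [diagonalStr_apply, diagonalStr_apply]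
  refine Prod.ext (hL _) (ContinuousLinearMap.ext fun v => ?_)
  simp [hL]

/-- `L ⊕ (-L*)` is skew for the neutral pairing for every `L`, and `e^Θ` is an isometry because `Θ`
is alternating. -/
theorem diagonalStr_skew (a b : GT F x) :
    pair x (𝔤.diagonalStr L a) b + pair x a (𝔤.diagonalStr L b) = 0 := by
  rw [diagonalStr_apply, diagonalStr_apply, pairing_apply, pairing_apply]
  simp only [_root_.sub_apply, ContinuousLinearMap.comp_apply]
  rw [Θ_swap 𝔤 x (L a.1), Θ_swap 𝔤 x (L b.1)]
  ring

/-- `E` is the image under `e^Θ` of the graph of `g`. The map `L ⊕ (-L*)` preserves this graph when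
`g(L u) = -g(u) ∘ L`, which is skewness of `L`. -/
theorem diagonalStr_mem_E (hL : ∀ u v, 𝔤.g x (L u) v + 𝔤.g x u (L v) = 0) (a : GT F x)
    (ha : a ∈ 𝔤.E x) : 𝔤.diagonalStr L a ∈ 𝔤.E x := by
  have ha := mem_graph.1 ha
  refine mem_graph.2 (ContinuousLinearMap.ext fun v => ?_)
  rw [diagonalStr_apply, ha]
  have := hL a.1 v
  simp only [_root_.sub_apply, _root_.add_apply, ContinuousLinearMap.comp_apply]
  linarith

omit [FiniteDimensional ℝ F] in
-- The conditions `K ≠ ±Id` are automatic: a non-zero multiple of the identity is not skew for the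
-- pairing, which is non-zero when `n ≥ 1`.
theorem mem_reflector (hn : 1 ≤ n) {K : EndT F x} (sq : ∀ a, K (K a) = a)
    (skew : ∀ a b, pair x (K a) b + pair x a (K b) = 0) (hE : ∀ a ∈ 𝔤.E x, K a ∈ 𝔤.E x) :
    (⟨x, K⟩ : EndTot F M) ∈ 𝔤.reflector := by
  refine ⟨⟨sq, fun h => ?_, fun h => ?_, skew⟩, hE⟩
  · have h : K = ContinuousLinearMap.id ℝ _ := h
    exact ne_of_skew 𝔤 hn K 1 one_ne_zero skew fun a => by rw [h, one_smul]; rfl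
  · have h : K = -ContinuousLinearMap.id ℝ _ := h
    exact ne_of_skew 𝔤 hn K (-1) (by norm_num) skew fun a => by rw [h, neg_one_smul]; rfl

/-- `signs 1 (-1)` is the reflection that fixes `E` and reverses `E^⊥`. As `E^⊥ = {X - g(X) +
Θ(X)}`, the covector `g(u)` is half the difference of the elements of `E` and `E^⊥` over `u`. The
reflection turns this into half their sum, in which `g` cancels instead of `u`. -/
theorem signs_dual (u : TangentSpace 𝓘(ℝ, F) x) :
    𝔤.signs 1 (-1) x (0, 𝔤.g x u) = (u, 𝔤.Θ x u) := by
  have h1 : ((1 / 2 : ℝ) • (u, (𝔤.g x + 𝔤.Θ x) u) : GT F x) ∈ 𝔤.E x :=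
    Submodule.smul_mem _ _ (mem_graph.2 rfl)
  have h2 : ((-1 / 2 : ℝ) • (u, 𝔤.Θ x u - 𝔤.g x u) : GT F x) ∈ 𝔤.Eperp x := by
    refine Submodule.smul_mem _ _ fun e he => ?_
    show pair x e _ = 0
    rw [pairing_apply, mem_graph.1 he]
    simp only [_root_.sub_apply, _root_.add_apply]
    rw [𝔤.symm x u, Θ_swap 𝔤 x u]
    ring
  have h3 : ((0, 𝔤.g x u) : GT F x) =
      (1 / 2 : ℝ) • (u, (𝔤.g x + 𝔤.Θ x) u) + (-1 / 2 : ℝ) • (u, 𝔤.Θ x u - 𝔤.g x u) := by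
    refine Prod.ext ?_ ?_
    · show (0 : TangentSpace 𝓘(ℝ, F) x) = (1 / 2 : ℝ) • u + (-1 / 2 : ℝ) • u
      module
    · show 𝔤.g x u = (1 / 2 : ℝ) • (𝔤.g x u + 𝔤.Θ x u) + (-1 / 2 : ℝ) • (𝔤.Θ x u - 𝔤.g x u)
      module
  rw [h3, signs_apply 𝔤 1 (-1) h1 h2]
  refine Prod.ext ?_ ?_
  · show (1 : ℝ) • (1 / 2 : ℝ) • u + (-1 : ℝ) • (-1 / 2 : ℝ) • u = u
    module
  · show (1 : ℝ) • (1 / 2 : ℝ) • (𝔤.g x u + 𝔤.Θ x u) +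
      (-1 : ℝ) • (-1 / 2 : ℝ) • (𝔤.Θ x u - 𝔤.g x u) = 𝔤.Θ x u
    module

theorem signs_signs (a : GT F x) : 𝔤.signs 1 (-1) x (𝔤.signs 1 (-1) x a) = a := by
  obtain ⟨u, hu, v, hv, rfl⟩ := 𝔤.exists_add x a
  rw [signs_apply 𝔤 1 (-1) hu hv, signs_apply 𝔤 1 (-1) (Submodule.smul_mem _ _ hu)
    (Submodule.smul_mem _ _ hv), one_smul, one_smul, smul_smul, neg_mul_neg, one_mul, one_smul]

variable (𝔤) in
/-- A point of the reflector space which maps `T*` to itself and whose `T`-component is not the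
identity. -/
theorem exists_reflector_diagonal (hn : 1 ≤ n) (x : M) :
    ∃ K ∈ 𝔤.reflector, (∀ α, (K.2 (0, α)).1 = 0) ∧ (∃ u, (K.2 (u, 0)).1 ≠ u) ∧
      ∃ α : CT F K.1, α ≠ 0 := by
  obtain ⟨L, h1, h2, u, h3, -, h4⟩ := 𝔤.exists_skew_product hn x
  exact ⟨⟨x, 𝔤.diagonalStr L⟩, mem_reflector hn (diagonalStr_sq h1) diagonalStr_skew
    -- The vector component depends on the vector argument alone, through `L`. The vector `u` shows
    -- that it is not the identity, and `g(u)` supplies the non-zero covector.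
    (diagonalStr_mem_E h2), fun α => map_zero L, ⟨u, h3⟩, 𝔤.g x u, h4⟩

variable (𝔤) in
/-- A point of the reflector space which does not map `T*` to itself. -/
theorem exists_reflector_offDiagonal (hn : 1 ≤ n) (x : M) :
    ∃ K ∈ 𝔤.reflector, ∃ α, (K.2 (0, α)).1 ≠ 0 := by
  obtain ⟨L, h1, h2, u, -, h3, -⟩ := 𝔤.exists_skew_product hn x
  have hc := signs_comm 𝔤 1 (-1) (diagonalStr_skew (𝔤 := 𝔤) (L := L)) (diagonalStr_mem_E h2)
  -- Composition with the reflection changes `(K', K'')` into `(K', -K'')`. Since the reflection is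
  -- a self-adjoint involution that commutes with `K`, the composite is again a skew involution.
  refine ⟨⟨x, 𝔤.diagonalStr L ∘L 𝔤.signs 1 (-1) x⟩, mem_reflector hn (fun a => ?_) (fun a b => ?_)
    (fun a ha => ?_), 𝔤.g x u, ?_⟩
  · simp only [ContinuousLinearMap.comp_apply]
    rw [hc, signs_signs, diagonalStr_sq h1]
  · simp only [ContinuousLinearMap.comp_apply]
    rw [← hc b, ← signs_adj, diagonalStr_skew]
  -- On `E` the reflection is the identity, so the composite acts there as the diagonal structure.
  · have := signs_apply 𝔤 1 (-1) ha (Submodule.zero_mem (𝔤.Eperp x))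
    rw [add_zero, smul_zero, add_zero, one_smul] at this
    rw [ContinuousLinearMap.comp_apply, this]
    exact diagonalStr_mem_E h2 a ha
  -- The reflection sends the covector `g(u)` to `u + Θ(u)`, and the diagonal structure then gives
  -- the vector component `L u ≠ 0`.
  · simp only [ContinuousLinearMap.comp_apply]
    rw [signs_dual]
    exact h3

/-! ### Non-equivalence on the reflector space -/

variable (𝔤) {D : CovariantDerivative 𝓘(ℝ, F) (GF F) (fun x : M => GT F x)}

/-- The structures `𝒦_ε` are not transforms of structures that preserve the cotangent spaces. -/
theorem not_isBTransform_of_fst_eq_zero [Nonempty M] (hn : 1 ≤ n) (hD : 𝔤.IsDirectSumConnection D)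
    (ε : Fin 4) {J : ∀ K : 𝔤.reflector, Module.End ℝ (Gen (𝔤.tangent K))}
    (hJ : ∀ K ξ, (J K (0, ξ)).1 = 0) : ¬ 𝔤.IsBTransform (𝔤.reflectorStr hn hD ε) J := by
  rintro ⟨B, -, h⟩
  obtain ⟨K, hK, α, hα⟩ := 𝔤.exists_reflector_offDiagonal hn (Classical.arbitrary M)
  exact hα (fst_eq_zero_of_liftStr_eq (hJ ⟨K, hK⟩) (h ⟨K, hK⟩) α)

theorem not_isBTransform_symplecticStr [Nonempty M] (hn : 1 ≤ n)
    (hD : 𝔤.IsDirectSumConnection D) (ε : Fin 4)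
    (w : ∀ K : 𝔤.reflector, LinearMap.BilinForm ℝ (𝔤.tangent K)) (hw : ∀ K, (w K).Nondegenerate) :
    ¬ 𝔤.IsBTransform (𝔤.reflectorStr hn hD ε) (fun K => symplecticStr (w K) (hw K)) := by
  rintro ⟨B, -, h⟩
  -- At a point preserving `T*` the invariant of `𝒦_ε` is zero, whereas that of `K_ω` is injective
  -- on a non-trivial space.
  obtain ⟨K, hK, h0, -, α, hα⟩ := 𝔤.exists_reflector_diagonal hn (Classical.arbitrary M)
  exact hα (dual_eq_zero_of_liftStr_eq_symplecticStr h0 (h ⟨K, hK⟩) α)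

theorem not_isBTransform_bivectorStr [Nonempty M] (hn : 1 ≤ n)
    (hD : 𝔤.IsDirectSumConnection D) (ε : Fin 4)
    (b : ∀ K : 𝔤.reflector, ⋀[ℝ]^2 (𝔤.tangent K)) :
    ¬ 𝔤.IsBTransform (𝔤.reflectorStr hn hD ε) (fun K => bivectorStr (b K)) := by
  rintro ⟨B, -, h⟩
  -- The same kind of point is used, now because `K` moves the vector component of `u`, which `K_π`
  -- with vanishing contractions cannot do.
  obtain ⟨K, hK, h0, ⟨u, hu⟩, -⟩ := 𝔤.exists_reflector_diagonal hn (Classical.arbitrary M)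
  exact hu (fst_eq_of_liftStr_eq_bivectorStr h0 (h ⟨K, hK⟩) u)

end GeneralizedMetric

end Fibre

end GenReflector

theorem mainTheorem7 {F : Type*} [NormedAddCommGroup F] [NormedSpace ℝ F] [FiniteDimensional ℝ F]
    {M : Type*} [TopologicalSpace M] [ChartedSpace F M] [IsManifold 𝓘(ℝ, F) ∞ M] [Nonempty M]
    {n : ℕ} (hn : 1 ≤ n) (𝔤 : GenReflector.GeneralizedMetric F M n)
    (D : CovariantDerivative 𝓘(ℝ, F) (GenReflector.GF F) (fun x : M => GenReflector.GT F x))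
    (hD : 𝔤.IsDirectSumConnection D) (ε : Fin 4) :
    (¬ 𝔤.IsBTransform (𝔤.reflectorStr hn hD ε) (fun _ => GenReflector.trivialStr)) ∧
    (∀ (w : ∀ K : 𝔤.reflector, LinearMap.BilinForm ℝ (𝔤.tangent K)) (_ : ∀ K, (w K).IsAlt)
      (hw : ∀ K, (w K).Nondegenerate),
      ¬ 𝔤.IsBTransform (𝔤.reflectorStr hn hD ε) (fun K => GenReflector.symplecticStr (w K) (hw K))) ∧
    (∀ b : ∀ K : 𝔤.reflector, ⋀[ℝ]^2 (𝔤.tangent K),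
      ¬ 𝔤.IsBTransform (𝔤.reflectorStr hn hD ε) (fun K => GenReflector.bivectorStr (b K))) ∧
    (∀ P : ∀ K : 𝔤.reflector, Module.End ℝ (𝔤.tangent K),
      (∀ K, GenReflector.IsProductStr (P K)) →
      ¬ 𝔤.IsBTransform (𝔤.reflectorStr hn hD ε) (fun K => GenReflector.productStr (P K))) := by
  -- The trivial structure and `K_P` are covered by one argument: on a covector their vector
  -- components are `0` and `P 0`.
  refine ⟨𝔤.not_isBTransform_of_fst_eq_zero hn hD ε fun K ξ => rfl,
    fun w _ hw => 𝔤.not_isBTransform_symplecticStr hn hD ε w hw,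
    fun b => 𝔤.not_isBTransform_bivectorStr hn hD ε b,
    fun P _ => 𝔤.not_isBTransform_of_fst_eq_zero hn hD ε fun K ξ => map_zero (P K)⟩
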